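/- Setting. Formulas are first-order formulas built with $\land,\lor,\to,\exists,\forall,\bot$ (and $\neg\varphi:\equiv\varphi\to\bot$) in the language with equality and a function symbol for every definition of a primitive recursive function. $\mathbf{HA}$ (Heyting arithmetic) is the intuitionistic theory with the axioms $S(x)\neq 0$ and $S(x)=S(y)\to x=y$, the defining equations of the primitive recursive functions and the induction scheme for all formulas. $\Sigma_0=\Pi_0$ is the set of quantifier-free formulas; $\Sigma_{k+1}$ is the set of formulas $\exists x_1\cdots\exists x_n\varphi$ and $\Pi_{k+1}$ the set of formulas $\forall x_1\cdots\forall x_n\varphi$ with $n\ge 1$ and $\varphi\in\Pi_k$, respectively $\varphi\in\Sigma_k$; $\Sigma_{-1}=\emptyset$. The dual $\varphi^\bot$ of a prenex formula is given by $\varphi^\bot:\equiv\neg\varphi$ for quantifier-free $\varphi$, $(\forall x\varphi)^\bot:\equiv\exists x\,\varphi^\bot$ and $(\exists x\varphi)^\bot:\equiv\forall x\,\varphi^\bot$. For sets $\Gamma,\Theta$ of formulas let $\Gamma\lor\Theta=\{\varphi\lor\psi:\varphi\in\Gamma,\psi\in\Theta\}$, $\neg\Gamma=\{\neg\varphi:\varphi\in\Gamma\}$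 and $\neg\neg\Gamma=\{\neg\neg\varphi:\varphi\in\Gamma\}$, and consider the schemata - $\mathrm{LEM}_\Gamma$: $\varphi\lor\neg\varphi$ for $\varphi\in\Gamma$; - $\mathrm{DNE}_\Gamma$: $\neg\neg\varphi\to\varphi$ for $\varphi\in\Gamma$; - $\mathrm{DML}_\Gamma$: $\neg(\varphi\land\psi)\to\neg\varphi\lor\neg\psi$ for $\varphi,\psi\in\Gamma$; - $\mathrm{DML}_\Gamma^\bot$: $\neg(\varphi\land\psi)\to\varphi^\bot\lor\psi^\bot$ for $\varphi,\psi\in\Gamma$ (here the formulas in $\Gamma$ are prenex). Where $\Delta_k$ occurs in the index of a schema, each formula $\varphi$ taken from $\Delta_k$ ranges over $\Sigma_k$, and the instance gets the premise $\varphi\leftrightarrow\varphi'$ with an arbitrary $\varphi'\in\Pi_k$ (the conjunction of two such premises if two formulas are taken from $\Delta_k$). For example, $\mathrm{LEM}_{\Delta_k}$ is $(\varphi\leftrightarrow\varphi')\to\varphi\lor\neg\varphi$ for $\varphi\in\Sigma_k$, $\varphi'\in\Pi_k$, and $\mathrm{DNE}_{\neg\Delta_k\lor\Pi_k}$ is $(\varphi\leftrightarrow\varphi')\to(\neg\neg(\neg\varphi\lor\psi)\to\neg\varphi\lor\psi)$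 for $\varphi\in\Sigma_k$, $\varphi',\psi\in\Pi_k$. For a schema $P$, $\mathbf{HA}+P$ is $\mathbf{HA}$ together with the universal closures of all instances of $P$. Schemata $P,Q$ are equivalent over $\mathbf{HA}$ if $\mathbf{HA}+P$ proves every instance of $Q$ and $\mathbf{HA}+Q$ proves every instance of $P$; $P+Q$ denotes the union of $P$ and $Q$. Statement. For every natural number $k\ge 0$: 1. For each $\Gamma'\in\{\Sigma_k,\Delta_k,\neg\Pi_k,\neg\Delta_k,\neg\neg\Sigma_k,\neg\neg\Delta_k\}$, $\mathrm{DNE}_{\Sigma_k\lor\Gamma'}$ is equivalent to $\mathrm{DNE}_{\Sigma_k}$ over $\mathbf{HA}$. 2. $\mathrm{LEM}_{\Sigma_k}$, $\mathrm{DNE}_{\Sigma_k\lor\Pi_k}$, $\mathrm{DNE}_{\Sigma_k\lor\neg\Sigma_k}$ and $\mathrm{DNE}_{\Sigma_k\lor\neg\neg\Pi_k}$ are pairwise equivalent over $\mathbf{HA}$. 3. $\mathrm{LEM}_{\Pi_k}$, $\mathrm{DNE}_{\neg\Pi_k\lor\Pi_k}$ and $\mathrm{DNE}_{\neg\neg\Sigma_k\lor\Pi_k}$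 are pairwise equivalent over $\mathbf{HA}$. 4. $\mathrm{DML}_{\Sigma_k}^\bot$, $\mathrm{DNE}_{\Pi_k\lor\Pi_k}$, $\mathrm{DNE}_{\Pi_k\lor\neg\Sigma_k}$ and $\mathrm{DNE}_{\Pi_k\lor\neg\neg\Pi_k}$ are pairwise equivalent over $\mathbf{HA}$. 5. For each $\Gamma'\in\{\Sigma_k,\Pi_k,\Delta_k,\neg\Sigma_k,\neg\Pi_k\}$ and each $\Gamma''\in\{\Delta_k,\neg\Delta_k,\neg\neg\Delta_k\}$, the schemata $\mathrm{LEM}_{\Delta_k}$, $\mathrm{DNE}_{\Delta_k\lor\neg\Gamma'}$ and $\mathrm{DNE}_{\Gamma''\lor\Pi_k}$ are pairwise equivalent over $\mathbf{HA}$. 6. $\mathrm{DNE}_{\Delta_k\lor\Delta_k}$, $\mathrm{DNE}_{\Delta_k\lor\neg\neg\Delta_k}$ and $\mathrm{DML}_{\neg\Delta_k}+\mathrm{DNE}_{\Sigma_{k-1}}$ are pairwise equivalent over $\mathbf{HA}$. -/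

import Mathlib

namespace HeytingArith

open FirstOrder

/-! ### The language of arithmetic with all primitive recursive functions -/

/-- Function symbols, by arity: one symbol for every definition of a primitive recursive function.
`comp f g` stands for `x⃗ ↦ f (g₀ x⃗, …, gₘ₋₁ x⃗)`, and `prec f g` for the function `h` with
`h (0, x⃗) = f x⃗` and `h (y + 1, x⃗) = g (y, h (y, x⃗), x⃗)`. -/
inductive PRSym : ℕ → Type
  | zero : PRSym 0
  | succ : PRSym 1
  | proj {n : ℕ} (i : Fin n) : PRSym n
  | comp {m n : ℕ} (f : PRSym m) (g : Fin m → PRSym n) : PRSym n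
  | prec {n : ℕ} (f : PRSym n) (g : PRSym (n + 2)) : PRSym (n + 1)

/-- The first-order language of arithmetic; equality is the only predicate. -/
abbrev prLang : Language := ⟨PRSym, fun _ => Empty⟩

/-- Terms, with variables numbered by `ℕ` (de Bruijn indices). -/
abbrev Tm : Type := prLang.Term ℕ

/-- The variable number `i`. -/
abbrev v (i : ℕ) : Tm := Language.Term.var i

/-- A function symbol applied to terms. -/
abbrev ap {n : ℕ} (f : PRSym n) (ts : Fin n → Tm) : Tm := Language.Term.func (L := prLang) f ts

/-- The constant `0`. -/
def zeroT : Tm := ap PRSym.zero Fin.elim0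

/-- The successor of a term. -/
def succT (t : Tm) : Tm := ap PRSym.succ (fun _ => t)

/-- First-order formulas, with de Bruijn indices: `all φ` and `ex φ` bind variable `0` of `φ`, and
variable `i + 1` of `φ` is variable `i` of `all φ` and of `ex φ`. -/
inductive Fml : Type
  | falsum : Fml
  | eq (s t : Tm) : Fml
  | and (φ ψ : Fml) : Fml
  | or (φ ψ : Fml) : Fml
  | imp (φ ψ : Fml) : Fml
  | all (φ : Fml) : Fml
  | ex (φ : Fml) : Fml

/-- Negation `φ → ⊥`. -/
abbrev Fml.neg (φ : Fml) : Fml := Fml.imp φ Fml.falsum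

/-- The biconditional `(φ → ψ) ∧ (ψ → φ)`. -/
abbrev Fml.iff (φ ψ : Fml) : Fml := Fml.and (Fml.imp φ ψ) (Fml.imp ψ φ)

/-- The substitution `σ` moved under one quantifier. -/
def up (σ : ℕ → Tm) : ℕ → Tm
  | 0 => v 0
  | i + 1 => (σ i).subst (fun j => v (j + 1))

/-- Simultaneous capture-avoiding substitution of `σ i` for every free variable `i`. -/
def Fml.subst : Fml → (ℕ → Tm) → Fml
  | .falsum, _ => .falsum
  | .eq s t, σ => .eq (s.subst σ) (t.subst σ)
  | .and φ ψ, σ => .and (φ.subst σ) (ψ.subst σ)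
  | .or φ ψ, σ => .or (φ.subst σ) (ψ.subst σ)
  | .imp φ ψ, σ => .imp (φ.subst σ) (ψ.subst σ)
  | .all φ, σ => .all (φ.subst (up σ))
  | .ex φ, σ => .ex (φ.subst (up σ))

/-- Weakening: the same formula, regarded under one more quantifier. -/
def Fml.shift (φ : Fml) : Fml := φ.subst (fun i => v (i + 1))

/-- The substitution that puts `t` for variable `0` and lowers all other variables by one. -/
def instSubst (t : Tm) : ℕ → Tm
  | 0 => t
  | i + 1 => v i

/-- `φ(t)`, for a formula `φ(x)` whose distinguished variable `x` is variable `0`. -/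
def Fml.inst (φ : Fml) (t : Tm) : Fml := φ.subst (instSubst t)

/-- The substitution that puts `x + 1` for `x`, where `x` is variable `0`. -/
def succSubst : ℕ → Tm
  | 0 => succT (v 0)
  | i + 1 => v (i + 1)

/-- All variables of the term are smaller than this number. -/
def tmBound : Tm → ℕ
  | .var i => i + 1
  | .func _ ts => Finset.univ.sup (fun i => tmBound (ts i))

/-- All free variables of the formula are smaller than this number. -/
def Fml.fvBound : Fml → ℕ
  | .falsum => 0
  | .eq s t => max (tmBound s) (tmBound t)
  | .and φ ψ => max φ.fvBound ψ.fvBound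
  | .or φ ψ => max φ.fvBound ψ.fvBound
  | .imp φ ψ => max φ.fvBound ψ.fvBound
  | .all φ => φ.fvBound - 1
  | .ex φ => φ.fvBound - 1

/-- The universal closure of a formula. -/
def Fml.univClosure (φ : Fml) : Fml := Fml.all^[φ.fvBound] φ

/-! ### Intuitionistic provability and Heyting arithmetic -/

/-- Intuitionistic natural deduction with equality: `Prf T Γ φ` says that `φ` is derivable from the
axioms `T` (a set of sentences) and the open assumptions `Γ`. -/
inductive Prf (T : Set Fml) : List Fml → Fml → Prop
  | ax {Γ : List Fml} {φ : Fml} : φ ∈ T → Prf T Γ φ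
  | hyp {Γ : List Fml} {φ : Fml} : φ ∈ Γ → Prf T Γ φ
  | falsumE {Γ : List Fml} {φ : Fml} : Prf T Γ Fml.falsum → Prf T Γ φ
  | andI {Γ : List Fml} {φ ψ : Fml} : Prf T Γ φ → Prf T Γ ψ → Prf T Γ (Fml.and φ ψ)
  | andE₁ {Γ : List Fml} {φ ψ : Fml} : Prf T Γ (Fml.and φ ψ) → Prf T Γ φ
  | andE₂ {Γ : List Fml} {φ ψ : Fml} : Prf T Γ (Fml.and φ ψ) → Prf T Γ ψ
  | orI₁ {Γ : List Fml} {φ ψ : Fml} : Prf T Γ φ → Prf T Γ (Fml.or φ ψ)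
  | orI₂ {Γ : List Fml} {φ ψ : Fml} : Prf T Γ ψ → Prf T Γ (Fml.or φ ψ)
  | orE {Γ : List Fml} {φ ψ χ : Fml} :
      Prf T Γ (Fml.or φ ψ) → Prf T (φ :: Γ) χ → Prf T (ψ :: Γ) χ → Prf T Γ χ
  | impI {Γ : List Fml} {φ ψ : Fml} : Prf T (φ :: Γ) ψ → Prf T Γ (Fml.imp φ ψ)
  | impE {Γ : List Fml} {φ ψ : Fml} : Prf T Γ (Fml.imp φ ψ) → Prf T Γ φ → Prf T Γ ψ
  | allI {Γ : List Fml} {φ : Fml} : Prf T (Γ.map Fml.shift) φ → Prf T Γ (Fml.all φ)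
  | allE {Γ : List Fml} {φ : Fml} (t : Tm) : Prf T Γ (Fml.all φ) → Prf T Γ (φ.inst t)
  | exI {Γ : List Fml} {φ : Fml} (t : Tm) : Prf T Γ (φ.inst t) → Prf T Γ (Fml.ex φ)
  | exE {Γ : List Fml} {φ ψ : Fml} :
      Prf T Γ (Fml.ex φ) → Prf T (φ :: Γ.map Fml.shift) ψ.shift → Prf T Γ ψ
  | eqI {Γ : List Fml} (t : Tm) : Prf T Γ (Fml.eq t t)
  | eqE {Γ : List Fml} (φ : Fml) {s t : Tm} :
      Prf T Γ (Fml.eq s t) → Prf T Γ (φ.inst s) → Prf T Γ (φ.inst t)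

/-- The non-logical axioms of Heyting arithmetic, before universal closure. -/
inductive HAAxiom : Fml → Prop
  | succ_ne_zero : HAAxiom (Fml.neg (Fml.eq (succT (v 0)) zeroT))
  | succ_inj : HAAxiom (Fml.imp (Fml.eq (succT (v 0)) (succT (v 1))) (Fml.eq (v 0) (v 1)))
  | proj {n : ℕ} (i : Fin n) :
      HAAxiom (Fml.eq (ap (PRSym.proj i) (fun j => v j)) (v i))
  | comp {m n : ℕ} (f : PRSym m) (g : Fin m → PRSym n) :
      HAAxiom (Fml.eq (ap (PRSym.comp f g) (fun j => v j))
        (ap f (fun i => ap (g i) (fun j => v j))))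
  | prec_zero {n : ℕ} (f : PRSym n) (g : PRSym (n + 2)) :
      HAAxiom (Fml.eq (ap (PRSym.prec f g) (Fin.cons zeroT (fun j : Fin n => v j)))
        (ap f (fun j => v j)))
  | prec_succ {n : ℕ} (f : PRSym n) (g : PRSym (n + 2)) :
      HAAxiom (Fml.eq
        (ap (PRSym.prec f g) (Fin.cons (succT (v 0)) (fun j : Fin n => v (j + 1))))
        (ap g (Fin.cons (v 0) (Fin.cons
          (ap (PRSym.prec f g) (Fin.cons (v 0) (fun j : Fin n => v (j + 1))))
          (fun j : Fin n => v (j + 1))))))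
  | induction (φ : Fml) :
      HAAxiom (Fml.imp
        (Fml.and (φ.inst zeroT) (Fml.all (Fml.imp φ (φ.subst succSubst)))) (Fml.all φ))

/-- A principle is the set of its instances. -/
abbrev Principle : Type := Set Fml

/-- The axioms of `HA + P`: the universal closures of the axioms of Heyting arithmetic and of all
instances of `P`. -/
def HAplus (P : Principle) : Set Fml := Fml.univClosure '' ({φ | HAAxiom φ} ∪ P)

/-- `HA + P ⊢ Q`. -/
def Derives (P Q : Principle) : Prop := ∀ φ ∈ Q, Prf (HAplus P) [] φ

/-- `P` and `Q` are equivalent over `HA`. -/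
def EquivHA (P Q : Principle) : Prop := Derives P Q ∧ Derives Q P

/-! ### Prenex classes and duals -/

/-- Quantifier-free formulas. -/
def Fml.QF : Fml → Prop
  | .falsum => True
  | .eq _ _ => True
  | .and φ ψ => φ.QF ∧ ψ.QF
  | .or φ ψ => φ.QF ∧ ψ.QF
  | .imp φ ψ => φ.QF ∧ ψ.QF
  | .all _ => False
  | .ex _ => False

mutual

/-- `Σ_k`; each block consists of at least one quantifier. -/
def sigmaSet : ℕ → Set Fml
  | 0 => {φ | φ.QF}
  | k + 1 => {φ | ∃ n : ℕ, 1 ≤ n ∧ ∃ ψ ∈ piSet k, φ = Fml.ex^[n] ψ}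

/-- `Π_k`; each block consists of at least one quantifier. -/
def piSet : ℕ → Set Fml
  | 0 => {φ | φ.QF}
  | k + 1 => {φ | ∃ n : ℕ, 1 ≤ n ∧ ∃ ψ ∈ sigmaSet k, φ = Fml.all^[n] ψ}

end

/-- The dual of a prenex formula: it exchanges the quantifiers of the prefix and negates the
quantifier-free matrix. (It is used for prenex formulas only.) -/
def Fml.dual : Fml → Fml
  | .all φ => .ex φ.dual
  | .ex φ => .all φ.dual
  | φ => φ.neg

/-! ### Classes of formulas, possibly with a side condition, and the principles

A schema for `Δ_k` ranges over pairs `φ ∈ Σ_k`, `φ' ∈ Π_k`, and its instances are the corresponding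
instances for `φ` with the premise `φ ↔ φ'`. A member of a class is therefore a formula together
with an optional premise. -/

/-- A formula with an optional premise. -/
structure GFml where
  /-- the premise, if there is one -/
  premise : Option Fml
  /-- the formula -/
  fml : Fml

/-- Classes of formulas with optional premises. -/
abbrev Cls : Type := Set GFml

/-- A set of formulas as a class: no premises. -/
def Cls.ofSet (Γ : Set Fml) : Cls := {a | a.premise = none ∧ a.fml ∈ Γ}

/-- The class `Σ_k`. -/
def SigmaC (k : ℕ) : Cls := Cls.ofSet (sigmaSet k)

/-- The class `Σ_{k-1}`, which is empty for `k = 0`. -/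
def SigmaPredC : ℕ → Cls
  | 0 => ∅
  | k + 1 => SigmaC k

/-- The class `Π_k`. -/
def PiC (k : ℕ) : Cls := Cls.ofSet (piSet k)

/-- The class `Δ_k`: the formulas `φ ∈ Σ_k` with a premise `φ ↔ φ'`, where `φ' ∈ Π_k`. -/
def DeltaC (k : ℕ) : Cls :=
  {a | ∃ φ ∈ sigmaSet k, ∃ φ' ∈ piSet k, a = ⟨some (φ.iff φ'), φ⟩}

/-- The class of the negations of the members of a class. -/
def Cls.neg (C : Cls) : Cls := {a | ∃ b ∈ C, a = ⟨b.premise, b.fml.neg⟩}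

/-- The class of the double negations of the members of a class. -/
def Cls.dn (C : Cls) : Cls := C.neg.neg

/-- The class of the disjunctions of members of two classes. If both have a premise, then the
premise of the disjunction is the conjunction of the two. -/
def Cls.or (C D : Cls) : Cls :=
  {a | ∃ b ∈ C, ∃ c ∈ D, a = ⟨Option.merge Fml.and b.premise c.premise, Fml.or b.fml c.fml⟩}

/-- `p → φ` if there is a premise `p`, and `φ` otherwise. -/
def guarded : Option Fml → Fml → Fml
  | none, φ => φ
  | some p, φ => Fml.imp p φ

/-- The law of excluded middle `φ ∨ ¬φ`. -/
def LEM (C : Cls) : Principle :=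
  {χ | ∃ a ∈ C, χ = guarded a.premise (Fml.or a.fml a.fml.neg)}

/-- Double negation elimination `¬¬φ → φ`. -/
def DNE (C : Cls) : Principle :=
  {χ | ∃ a ∈ C, χ = guarded a.premise (Fml.imp a.fml.neg.neg a.fml)}

/-- De Morgan's law `¬(φ ∧ ψ) → ¬φ ∨ ¬ψ`. -/
def DML (C : Cls) : Principle :=
  {χ | ∃ a ∈ C, ∃ b ∈ C, χ = guarded (Option.merge Fml.and a.premise b.premise)
    (Fml.imp (Fml.and a.fml b.fml).neg (Fml.or a.fml.neg b.fml.neg))}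

/-- De Morgan's law with respect to duals `¬(φ ∧ ψ) → φ^⊥ ∨ ψ^⊥` (for prenex formulas). -/
def DMLDual (C : Cls) : Principle :=
  {χ | ∃ a ∈ C, ∃ b ∈ C, χ = guarded (Option.merge Fml.and a.premise b.premise)
    (Fml.imp (Fml.and a.fml b.fml).neg (Fml.or a.fml.dual b.fml.dual))}

end HeytingArith

open HeytingArith

namespace HeytingArith

open FirstOrder

/-! ### Substitution -/

-- The equivalences come from exchanging classes that coincide up to provable equivalence. Always
-- `φ^⊥ → ¬φ`, and `φ^⊥⊥ ↔ φ` because quantifier-free formulas are decidable in HA. With `DNE` for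
-- `Σ_{k-1}`, `¬φ ↔ φ^⊥` holds for `φ ∈ Σ_k`, so `Π_k` is stable and amounts to `¬Σ_k`
-- (`StablePred.neg_dual_imp`). With `DNE` for `Σ_k` the same holds for `φ ∈ Π_k`.
--
-- Every principle of the form `DNE` of a disjunction supplies the stability needed to rewrite its
-- own disjuncts: a refutable second disjunct leaves `DNE` of the first (`HasFalse.dne`), and
-- `Σ_{k-1}` embeds in `Σ_k`, `Π_k` and `Δ_k`. `Reduces.dne_or` then carries out the exchange.
--
-- What remains is short. `LEM` of `Γ` is `DNE` of `Γ ∨ ¬Γ`, as `¬¬(φ ∨ ¬φ)` is provable. `Σ_k` is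
-- closed under disjunction (`exists_sigma_iff_or`), which collapses the first group to `DNE` of
-- `Σ_k`. De Morgan's laws are `DNE` of disjunctions because `¬(¬φ ∧ ¬ψ)` is `¬¬(φ ∨ ψ)`.
-- Propositional steps are delegated to a verified prover (`Prf.taut`).

theorem tm_subst_subst (t : Tm) (σ τ : ℕ → Tm) :
    (t.subst σ).subst τ = t.subst (fun i => (σ i).subst τ) := by
  induction t with
  | var i => rfl
  | func f ts ih => simp only [Language.Term.subst, ih]

theorem tm_subst_var (t : Tm) : t.subst v = t := by
  induction t with
  | var i => rfl
  | func f ts ih => simp only [Language.Term.subst, ih]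

theorem up_v : up v = v := by
  funext i; cases i <;> rfl

theorem up_comp (σ τ : ℕ → Tm) :
    (fun i => (up σ i).subst (up τ)) = up (fun i => (σ i).subst τ) := by
  funext i
  cases i with
  | zero => rfl
  | succ i => simp only [up, tm_subst_subst]; rfl

namespace Fml

theorem subst_v (φ : Fml) : φ.subst v = φ := by
  induction φ <;> simp_all [subst, up_v, tm_subst_var]

theorem subst_subst (φ : Fml) (σ τ : ℕ → Tm) :
    (φ.subst σ).subst τ = φ.subst (fun i => (σ i).subst τ) := by
  induction φ generalizing σ τ <;> simp_all [subst, up_comp, tm_subst_subst]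

theorem shift_subst_up (φ : Fml) (σ : ℕ → Tm) :
    φ.shift.subst (up σ) = (φ.subst σ).shift := by
  simp only [shift, subst_subst]; rfl

theorem inst_subst (φ : Fml) (t : Tm) (σ : ℕ → Tm) :
    (φ.inst t).subst σ = (φ.subst (up σ)).inst (t.subst σ) := by
  simp only [inst, subst_subst]
  congr 1
  funext i
  cases i with
  | zero => rfl
  | succ i =>
    simp only [up, tm_subst_subst]
    exact (tm_subst_var _).symm

theorem shift_inst (φ : Fml) (t : Tm) : φ.shift.inst t = φ := by
  simp only [inst, shift, subst_subst]
  exact φ.subst_v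

theorem subst_up_shift_inst (φ : Fml) : (φ.subst (up fun i => v (i + 1))).inst (v 0) = φ := by
  simp only [inst, subst_subst]
  convert φ.subst_v using 2
  funext i
  cases i <;> rfl

end Fml

theorem up_eq_var {σ : ℕ → Tm} {n : ℕ} (h : ∀ i < n - 1, σ i = v i) : ∀ i < n, up σ i = v i := by
  intro i hi
  cases i with
  | zero => rfl
  | succ i => simp only [up, h i (by omega)]; rfl

theorem tm_subst_eq_self (t : Tm) (σ : ℕ → Tm) (h : ∀ i < tmBound t, σ i = v i) :
    t.subst σ = t := by
  induction t with
  | var i => exact h i (by simp [tmBound])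
  | func f ts ih =>
    simp only [Language.Term.subst]
    congr 1
    funext j
    refine ih j fun i hi => h i (lt_of_lt_of_le hi ?_)
    exact Finset.le_sup (f := fun i => tmBound (ts i)) (Finset.mem_univ j)

namespace Fml

theorem subst_eq_self (φ : Fml) (σ : ℕ → Tm) (h : ∀ i < φ.fvBound, σ i = v i) :
    φ.subst σ = φ := by
  induction φ generalizing σ with
  | falsum => rfl
  | eq s t =>
    simp only [fvBound, lt_max_iff] at h
    simp only [subst, tm_subst_eq_self s σ fun i hi => h i (.inl hi),
      tm_subst_eq_self t σ fun i hi => h i (.inr hi)]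
  | and φ ψ ihφ ihψ | or φ ψ ihφ ihψ | imp φ ψ ihφ ihψ =>
    simp only [fvBound, lt_max_iff] at h
    simp only [subst, ihφ σ fun i hi => h i (.inl hi), ihψ σ fun i hi => h i (.inr hi)]
  | all φ ih | ex φ ih => simp only [subst, ih _ (up_eq_var h)]

theorem fvBound_iterate_all (n : ℕ) (φ : Fml) : (all^[n] φ).fvBound = φ.fvBound - n := by
  induction n with
  | zero => rfl
  | succ n ih => rw [Function.iterate_succ_apply', fvBound, ih]; omega

theorem univClosure_subst (φ : Fml) (σ : ℕ → Tm) : φ.univClosure.subst σ = φ.univClosure :=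
  subst_eq_self _ _ fun i hi => by simp [univClosure, fvBound_iterate_all] at hi

end Fml

/-! ### Admissible rules -/

variable {P Q R : Principle} {Γ Δ : List Fml} {φ ψ χ : Fml}

namespace Prf

theorem weaken {T : Set Fml} (h : Prf T Γ φ) (hs : Γ ⊆ Δ) : Prf T Δ φ := by
  induction h generalizing Δ with
  | ax h => exact ax h
  | hyp h => exact hyp (hs h)
  | falsumE _ ih => exact falsumE (ih hs)
  | andI _ _ ih₁ ih₂ => exact andI (ih₁ hs) (ih₂ hs)
  | andE₁ _ ih => exact andE₁ (ih hs)
  | andE₂ _ ih => exact andE₂ (ih hs)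
  | orI₁ _ ih => exact orI₁ (ih hs)
  | orI₂ _ ih => exact orI₂ (ih hs)
  | orE _ _ _ ih ih₁ ih₂ =>
    exact orE (ih hs) (ih₁ (List.cons_subset_cons _ hs)) (ih₂ (List.cons_subset_cons _ hs))
  | impI _ ih => exact impI (ih (List.cons_subset_cons _ hs))
  | impE _ _ ih₁ ih₂ => exact impE (ih₁ hs) (ih₂ hs)
  | allI _ ih => exact allI (ih (List.map_subset _ hs))
  | allE t _ ih => exact allE t (ih hs)
  | exI t _ ih => exact exI t (ih hs)
  | exE _ _ ih ih₁ => exact exE (ih hs) (ih₁ (List.cons_subset_cons _ (List.map_subset _ hs)))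
  | eqI t => exact eqI t
  | eqE φ _ _ ih₁ ih₂ => exact eqE φ (ih₁ hs) (ih₂ hs)

theorem lift {T : Set Fml} (h : Prf T [] φ) : Prf T Γ φ := h.weaken (List.nil_subset _)

theorem map_shift_subst (Γ : List Fml) (σ : ℕ → Tm) :
    (Γ.map Fml.shift).map (Fml.subst · (up σ)) = (Γ.map (Fml.subst · σ)).map Fml.shift := by
  simp only [List.map_map]
  exact List.map_congr_left fun φ _ => φ.shift_subst_up σ

/-- The axioms are universal closures, hence sentences, and a substitution leaves them fixed; every
other rule commutes with substitution. -/
theorem subst (h : Prf (HAplus P) Γ φ) (σ : ℕ → Tm) :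
    Prf (HAplus P) (Γ.map (Fml.subst · σ)) (φ.subst σ) := by
  induction h generalizing σ with
  | ax h =>
    obtain ⟨θ, hθ, rfl⟩ := h
    rw [Fml.univClosure_subst]
    exact ax ⟨θ, hθ, rfl⟩
  | hyp h => exact hyp (List.mem_map_of_mem h)
  | falsumE _ ih => exact falsumE (ih σ)
  | andI _ _ ih₁ ih₂ => exact andI (ih₁ σ) (ih₂ σ)
  | andE₁ _ ih => exact andE₁ (ih σ)
  | andE₂ _ ih => exact andE₂ (ih σ)
  | orI₁ _ ih => exact orI₁ (ih σ)
  | orI₂ _ ih => exact orI₂ (ih σ)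
  | orE _ _ _ ih ih₁ ih₂ => exact orE (ih σ) (ih₁ σ) (ih₂ σ)
  | impI _ ih => exact impI (ih σ)
  | impE _ _ ih₁ ih₂ => exact impE (ih₁ σ) (ih₂ σ)
  | allI _ ih => exact allI (map_shift_subst _ σ ▸ ih (up σ))
  | allE t _ ih => exact Fml.inst_subst _ t σ ▸ allE (t.subst σ) (ih σ)
  | exI t _ ih => exact exI (t.subst σ) (Fml.inst_subst _ t σ ▸ ih σ)
  | exE _ _ ih ih₁ =>
    refine exE (ih σ) ?_
    have h := ih₁ (up σ)
    rwa [List.map_cons, map_shift_subst, Fml.shift_subst_up] at h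
  | eqI t => exact eqI _
  | eqE φ _ _ ih₁ ih₂ =>
    rw [Fml.inst_subst]
    exact eqE _ (ih₁ σ) (Fml.inst_subst φ _ σ ▸ ih₂ σ)

theorem shift (h : Prf (HAplus P) Γ φ) : Prf (HAplus P) (Γ.map Fml.shift) φ.shift := h.subst _

theorem inst (h : Prf (HAplus P) [] φ) (t : Tm) : Prf (HAplus P) Γ (φ.inst t) := (h.subst _).lift

theorem open_all (h : Prf (HAplus P) Γ (.all φ)) : Prf (HAplus P) (Γ.map Fml.shift) φ := by
  have := allE (v 0) h.shift
  rwa [Fml.subst_up_shift_inst] at this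

theorem of_iterate_all (n : ℕ) (h : Prf (HAplus P) [] (Fml.all^[n] φ)) :
    Prf (HAplus P) [] φ := by
  induction n with
  | zero => exact h
  | succ n ih =>
    rw [Function.iterate_succ_apply'] at h
    exact ih h.open_all

theorem iterate_all {T : Set Fml} (n : ℕ) (h : Prf T [] φ) : Prf T [] (Fml.all^[n] φ) := by
  induction n with
  | zero => exact h
  | succ n ih =>
    rw [Function.iterate_succ_apply']
    exact allI ih

theorem of_axiom (h : HAAxiom φ) : Prf (HAplus P) [] φ :=
  of_iterate_all _ (ax ⟨φ, .inl h, rfl⟩)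

theorem of_mem (h : φ ∈ P) : Prf (HAplus P) [] φ :=
  of_iterate_all _ (ax ⟨φ, .inr h, rfl⟩)

/-- Each use of an axiom from `Q` is replaced by its derivation from `P`, generalized to the
universal closure. -/
theorem of_derives (hd : Derives P Q) (h : Prf (HAplus Q) Γ φ) : Prf (HAplus P) Γ φ := by
  induction h with
  | ax h =>
    obtain ⟨θ, hθ | hθ, rfl⟩ := h
    · exact ax ⟨θ, .inl hθ, rfl⟩
    · exact (iterate_all _ (hd θ hθ)).lift
  | hyp h => exact hyp h
  | falsumE _ ih => exact falsumE ih
  | andI _ _ ih₁ ih₂ => exact andI ih₁ ih₂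
  | andE₁ _ ih => exact andE₁ ih
  | andE₂ _ ih => exact andE₂ ih
  | orI₁ _ ih => exact orI₁ ih
  | orI₂ _ ih => exact orI₂ ih
  | orE _ _ _ ih ih₁ ih₂ => exact orE ih ih₁ ih₂
  | impI _ ih => exact impI ih
  | impE _ _ ih₁ ih₂ => exact impE ih₁ ih₂
  | allI _ ih => exact allI ih
  | allE t _ ih => exact allE t ih
  | exI t _ ih => exact exI t ih
  | exE _ _ ih ih₁ => exact exE ih ih₁
  | eqI t => exact eqI t
  | eqE φ _ _ ih₁ ih₂ => exact eqE φ ih₁ ih₂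

end Prf

theorem Derives.refl (P : Principle) : Derives P P := fun _ h => .of_mem h

theorem Derives.trans (h : Derives P Q) (h' : Derives Q R) : Derives P R :=
  fun φ hφ => (h' φ hφ).of_derives h

theorem EquivHA.symm (h : EquivHA P Q) : EquivHA Q P := ⟨h.2, h.1⟩

theorem EquivHA.trans (h : EquivHA P Q) (h' : EquivHA Q R) : EquivHA P R :=
  ⟨h.1.trans h'.1, h'.2.trans h.2⟩

/-! ### A prover for intuitionistic propositional logic -/

/-- Propositional formulas. -/
inductive PF : Type
  | atom (n : ℕ)
  | bot
  | and (a b : PF)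
  | or (a b : PF)
  | imp (a b : PF)

namespace PF

/-- The arithmetical formula obtained by putting formulas for the atoms. -/
def interp (e : List Fml) : PF → Fml
  | atom n => e.getD n .falsum
  | bot => .falsum
  | and a b => .and (a.interp e) (b.interp e)
  | or a b => .or (a.interp e) (b.interp e)
  | imp a b => .imp (a.interp e) (b.interp e)

/-- Boolean equality test. -/
def beq : PF → PF → Bool
  | atom m, atom n => m.beq n
  | bot, bot => true
  | and a b, and c d => a.beq c && b.beq d
  | or a b, or c d => a.beq c && b.beq d
  | imp a b, imp c d => a.beq c && b.beq d
  | _, _ => false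

theorem eq_of_beq : ∀ {a b : PF}, a.beq b = true → a = b := by
  intro a
  induction a <;> intro b h <;> cases b <;> simp_all [beq] <;> grind

/-- All ways to single out a member of a list. -/
def picks : List PF → List (PF × List PF)
  | [] => []
  | a :: l => (a, l) :: (picks l).map fun q => (q.1, a :: q.2)

theorem mem_of_picks {q : PF × List PF} {l : List PF} (h : q ∈ picks l) :
    ∀ a ∈ q.1 :: q.2, a ∈ l := by
  induction l generalizing q with
  | nil => simp [picks] at h
  | cons b l ih =>
    simp only [picks, List.mem_cons, List.mem_map] at h
    obtain rfl | ⟨r, hr, rfl⟩ := h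
    · simp
    · have := ih hr
      simp only [List.mem_cons] at this ⊢
      grind

/-- Proof search in the contraction-free sequent calculus. The first list holds the hypotheses
still to be decomposed. -/
def prove : ℕ → List PF → List PF → PF → Bool
  | 0, _, _, _ => false
  | _ + 1, bot :: _, _, _ => true
  | n + 1, and a b :: l, d, g => prove n (a :: b :: l) d g
  | n + 1, or a b :: l, d, g => prove n (a :: l) d g && prove n (b :: l) d g
  | n + 1, imp (and a b) c :: l, d, g => prove n (imp a (imp b c) :: l) d g
  | n + 1, imp (or a b) c :: l, d, g => prove n (imp a c :: imp b c :: l) d g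
  | n + 1, a :: l, d, g => prove n l (a :: d) g
  | n + 1, [], d, imp a b => prove n [a] d b
  | n + 1, [], d, and a b => prove n [] d a && prove n [] d b
  | n + 1, [], d, g =>
    d.any (beq g) ||
    (match g with
      | or a b => prove n [] d a || prove n [] d b
      | _ => false) ||
    (picks d).any fun q => match q.1 with
      | imp (imp a b) c => prove n [imp b c] q.2 (imp a b) && prove n [c] q.2 g
      | imp a b => q.2.any (beq a) && prove n [b] q.2 g
      | _ => false

end PF

namespace Prf

theorem head {T : Set Fml} : Prf T (φ :: Γ) φ := hyp (List.mem_cons_self ..)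

theorem tail {T : Set Fml} (h : Prf T Γ φ) : Prf T (ψ :: Γ) φ := h.weaken (List.subset_cons_self ..)

end Prf

namespace PF

open Prf in
-- Soundness of the search, by induction on the fuel `n`. Completeness is not needed: each tautology
-- used is checked by evaluation.
theorem interp_of_prove {T : Set Fml} (e : List Fml) (n : ℕ) :
    ∀ (l d : List PF) (g : PF) (Γ : List Fml), prove n l d g = true →
      (∀ p ∈ l, Prf T Γ (p.interp e)) → (∀ p ∈ d, Prf T Γ (p.interp e)) →
      Prf T Γ (g.interp e) := by
  induction n with
  | zero => intro l d g Γ h; simp [prove] at h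
  | succ n ih =>
    intro l d g Γ h hl hd
    have tl : ∀ {l : List PF} {ψ : Fml}, (∀ p ∈ l, Prf T Γ (p.interp e)) →
        ∀ p ∈ l, Prf T (ψ :: Γ) (p.interp e) := fun h p hp => (h p hp).tail
    have single : ∀ {Γ : List Fml} {a : PF}, Prf T Γ (a.interp e) →
        ∀ p ∈ [a], Prf T Γ (p.interp e) := fun h p hp => List.mem_singleton.1 hp ▸ h
    have nil : ∀ {Γ : List Fml}, ∀ p ∈ ([] : List PF), Prf T Γ (p.interp e) := by simp
    have atoms : ∀ {d : List PF} {a : PF}, (∀ p ∈ d, Prf T Γ (p.interp e)) →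
        d.any (beq a) = true → Prf T Γ (a.interp e) := by
      intro d a hd h
      obtain ⟨b, hb, hab⟩ := List.any_eq_true.1 h
      exact eq_of_beq hab ▸ hd b hb
    have main : ∀ g : PF, (picks d).any (fun q => match q.1 with
        | imp (imp a b) c => prove n [imp b c] q.2 (imp a b) && prove n [c] q.2 g
        | imp a b => q.2.any (beq a) && prove n [b] q.2 g
        | _ => false) = true → Prf T Γ (g.interp e) := by
      intro g h
      obtain ⟨⟨q, r⟩, hq, h⟩ := List.any_eq_true.1 h
      have hm := fun a ha => hd a (mem_of_picks hq a ha)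
      have hr : ∀ a ∈ r, Prf T Γ (a.interp e) := fun a ha => hm a (List.mem_cons_of_mem _ ha)
      have ha := hm q (List.mem_cons_self ..)
      dsimp only at h
      split at h
      · rename_i a b c
        rw [Bool.and_eq_true] at h
        -- Contraction-free left rule: `(a → b) → c` may be weakened to `b → c` while proving `a →
        -- b`, since `b` already yields `a → b`.
        have hbc : Prf T Γ ((imp b c).interp e) :=
          impI (impE (tail ha) (impI (tail head)))
        exact ih _ _ _ _ h.2 (single (impE ha (ih _ _ _ _ h.1 (single hbc) hr))) hr
      · rename_i a b _
        rw [Bool.and_eq_true] at h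
        exact ih _ _ _ _ h.2 (single (impE ha (atoms hr h.1))) hr
      · cases h
    cases l with
    | cons a l =>
      rw [List.forall_mem_cons] at hl
      obtain ⟨ha, hl⟩ := hl
      have other : prove n l (a :: d) g = true → Prf T Γ (g.interp e) := fun h =>
        ih _ _ _ _ h hl (List.forall_mem_cons.2 ⟨ha, hd⟩)
      cases a with
      | bot => exact falsumE ha
      | and a b =>
        exact ih _ _ _ _ h
          (List.forall_mem_cons.2 ⟨andE₁ ha, List.forall_mem_cons.2 ⟨andE₂ ha, hl⟩⟩) hd
      | or a b =>
        simp only [prove, Bool.and_eq_true] at h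
        exact orE ha (ih _ _ _ _ h.1 (List.forall_mem_cons.2 ⟨head, tl hl⟩) (tl hd))
          (ih _ _ _ _ h.2 (List.forall_mem_cons.2 ⟨head, tl hl⟩) (tl hd))
      | atom => exact other h
      | imp a c =>
        cases a with
        | and a b =>
          exact ih _ _ _ _ h (List.forall_mem_cons.2
            ⟨impI (impI (impE (tail (tail ha)) (andI (tail head) head))), hl⟩) hd
        | or a b =>
          exact ih _ _ _ _ h (List.forall_mem_cons.2 ⟨impI (impE (tail ha) (orI₁ head)),
            List.forall_mem_cons.2 ⟨impI (impE (tail ha) (orI₂ head)), hl⟩⟩) hd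
        | _ => exact other h
    | nil =>
      cases g with
      | imp a b => exact impI (ih _ _ _ _ h (single head) (tl hd))
      | and a b =>
        simp only [prove, Bool.and_eq_true] at h
        exact andI (ih _ _ _ _ h.1 nil hd) (ih _ _ _ _ h.2 nil hd)
      | or a b =>
        simp only [prove, Bool.or_eq_true] at h
        obtain (h | h | h) | h := h
        · exact atoms hd h
        · exact orI₁ (ih _ _ _ _ h nil hd)
        · exact orI₂ (ih _ _ _ _ h nil hd)
        · exact main _ h
      | _ =>
        simp only [prove, Bool.or_eq_true, Bool.false_eq_true, or_false] at h
        exact h.elim (atoms hd) (main _)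

/-- A numeral in a propositional scheme refers to the formula at that position of the list passed to
`Prf.taut`. -/
instance (n : ℕ) : OfNat PF n := ⟨atom n⟩

scoped infixr:25 " ⇒ " => PF.imp
scoped infixl:35 " ⋏ " => PF.and
scoped infixl:30 " ⋎ " => PF.or

/-- Negation. -/
abbrev neg (a : PF) : PF := .imp a .bot

/-- `(a → b) ∧ (b → a)`. -/
abbrev equiv (a b : PF) : PF := .and (.imp a b) (.imp b a)

scoped prefix:max "∼" => PF.neg
scoped infix:20 " ⇔ " => PF.equiv

end PF

/-- Intuitionistic propositional tautologies are derivable. -/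
theorem Prf.taut {T : Set Fml} (e : List Fml) (p : PF) (h : PF.prove 60 [] [] p = true) :
    Prf T Γ (p.interp e) :=
  PF.interp_of_prove e 60 [] [] p Γ h (by simp) (by simp)

/-! ### Arithmetic: decidability of quantifier-free formulas -/

theorem zeroT_subst (σ : ℕ → Tm) : zeroT.subst σ = zeroT := by
  simp only [zeroT, ap, Language.Term.subst]
  congr 1
  exact Subsingleton.elim _ _

theorem shift_tm_inst (s t : Tm) :
    Language.Term.subst (s.subst fun j => v (j + 1)) (instSubst t) = s := by
  rw [tm_subst_subst]
  exact tm_subst_var s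

namespace Prf

theorem eq_symm {T : Set Fml} {s t : Tm} (h : Prf T Γ (.eq s t)) : Prf T Γ (.eq t s) := by
  have := eqE (.eq (v 0) (s.subst fun j => v (j + 1))) h (by
    simp only [Fml.inst, Fml.subst, shift_tm_inst]
    exact eqI s)
  simp only [Fml.inst, Fml.subst, shift_tm_inst] at this
  exact this

theorem succ_congr {T : Set Fml} {s t : Tm} (h : Prf T Γ (.eq s t)) :
    Prf T Γ (.eq (succT s) (succT t)) := by
  have := eqE (.eq (Language.Term.subst (succT s) fun j => v (j + 1)) (succT (v 0))) h (by
    simp only [Fml.inst, Fml.subst, shift_tm_inst]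
    exact eqI _)
  simp only [Fml.inst, Fml.subst, shift_tm_inst] at this
  exact this

theorem succ_ne_zero (t : Tm) : Prf (HAplus P) Γ (Fml.eq (succT t) zeroT).neg := by
  have := (of_axiom (P := P) .succ_ne_zero).inst (Γ := Γ) t
  simp only [Fml.inst, Fml.subst, zeroT_subst] at this
  exact this

theorem succ_inj {s t : Tm} (h : Prf (HAplus P) Γ (.eq (succT s) (succT t))) :
    Prf (HAplus P) Γ (.eq s t) :=
  impE ((of_axiom (P := P) .succ_inj).subst fun | 0 => s | _ => t).lift h

theorem induct (h₀ : Prf (HAplus P) Γ (φ.inst zeroT))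
    (h : Prf (HAplus P) (φ :: Γ.map Fml.shift) (φ.subst succSubst)) :
    Prf (HAplus P) Γ (.all φ) :=
  impE (of_axiom (.induction φ)).lift (andI h₀ (allI (impI h)))

/-- Induction on the first variable with the second one universally quantified; the inner inductions
only separate zero from successors. -/
theorem eq_or_ne (s t : Tm) : Prf (HAplus P) Γ (.or (.eq s t) (Fml.eq s t).neg) := by
  have key : Prf (HAplus P) [] (.all (.all (.or (.eq (v 1) (v 0)) (Fml.eq (v 1) (v 0)).neg))) := by
    refine induct ?_ ?_
    · simp only [Fml.inst, Fml.subst, up, instSubst, Language.Term.subst, zeroT_subst]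
      refine induct ?_ ?_
      · simp only [Fml.inst, Fml.subst, zeroT_subst]
        exact orI₁ (eqI _)
      · simp only [Fml.subst, zeroT_subst]
        exact orI₂ (impI (impE (succ_ne_zero (v 0)) (eq_symm head)))
    · refine induct ?_ ?_
      · simp only [Fml.inst, Fml.subst]
        exact orI₂ (succ_ne_zero (v 0))
      -- The outer induction hypothesis, shifted under the inner variable, is instantiated at the
      -- predecessor of the second number.
      · have h : Prf (HAplus P)
            [.or (.eq (succT (v 1)) (v 0)) (Fml.eq (succT (v 1)) (v 0)).neg,
              .all (.or (.eq (v 2) (v 0)) (Fml.eq (v 2) (v 0)).neg)]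
            (.or (.eq (v 1) (v 0)) (Fml.eq (v 1) (v 0)).neg) :=
          allE (v 0) (tail head)
        exact orE h (orI₁ (succ_congr head)) (orI₂ (impI (impE (tail head) (succ_inj head))))
  have := (key.open_all.open_all).subst (fun | 0 => t | _ => s)
  exact this.lift

open PF in
theorem em_of_qf (h : φ.QF) : Prf (HAplus P) Γ (.or φ φ.neg) := by
  induction φ with
  | falsum => exact taut [] (.bot ⋎ ∼.bot) rfl
  | eq s t => exact eq_or_ne s t
  | and φ ψ ihφ ihψ =>
    exact ((taut [φ, ψ] ((0 ⋎ ∼0) ⇒ (1 ⋎ ∼1) ⇒ ((0 ⋏ 1) ⋎ ∼(0 ⋏ 1))) rfl).impE (ihφ h.1)).impE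
      (ihψ h.2)
  | or φ ψ ihφ ihψ =>
    exact ((taut [φ, ψ] ((0 ⋎ ∼0) ⇒ (1 ⋎ ∼1) ⇒ ((0 ⋎ 1) ⋎ ∼(0 ⋎ 1))) rfl).impE (ihφ h.1)).impE
      (ihψ h.2)
  | imp φ ψ ihφ ihψ =>
    exact ((taut [φ, ψ] ((0 ⋎ ∼0) ⇒ (1 ⋎ ∼1) ⇒ ((0 ⇒ 1) ⋎ ∼(0 ⇒ 1))) rfl).impE (ihφ h.1)).impE
      (ihψ h.2)
  | all => cases h
  | ex => cases h

/-! ### Quantifiers -/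

theorem of_all_shift {T : Set Fml} (h : Prf T Γ (Fml.all φ).shift) : Prf T Γ φ := by
  have := allE (v 0) h
  rwa [Fml.subst_up_shift_inst] at this

theorem ex_shift {T : Set Fml} (h : Prf T Γ φ) : Prf T Γ (Fml.ex φ).shift :=
  exI (v 0) (by rwa [Fml.subst_up_shift_inst])

theorem all_mono {T : Set Fml} (h : Prf T (Γ.map Fml.shift) (φ.imp ψ)) :
    Prf T Γ ((Fml.all φ).imp (.all ψ)) :=
  impI (allI (impE h.tail (of_all_shift head)))

theorem ex_mono {T : Set Fml} (h : Prf T (Γ.map Fml.shift) (φ.imp ψ)) :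
    Prf T Γ ((Fml.ex φ).imp (.ex ψ)) :=
  impI (exE head (ex_shift (impE h.tail.tail head)))

theorem ex_neg_imp {T : Set Fml} : Prf T Γ ((Fml.ex φ.neg).imp (Fml.all φ).neg) :=
  impI (impI (exE (tail head) (impE head (of_all_shift (tail head)))))

theorem all_neg_imp {T : Set Fml} : Prf T Γ ((Fml.all φ.neg).imp (Fml.ex φ).neg) :=
  impI (impI (exE head (impE (of_all_shift (tail (tail head))) head)))

theorem neg_ex_imp {T : Set Fml} : Prf T Γ ((Fml.ex φ).neg.imp (Fml.all φ.neg)) :=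
  impI (allI (impI (impE (tail head) (ex_shift head))))

theorem imp_trans {T : Set Fml} (h : Prf T Γ (φ.imp ψ)) (h' : Prf T Γ (ψ.imp χ)) :
    Prf T Γ (φ.imp χ) := impI (impE h'.tail (impE h.tail head))

theorem iff_refl {T : Set Fml} (φ : Fml) : Prf T Γ (φ.iff φ) := andI (impI head) (impI head)

theorem iff_symm {T : Set Fml} (h : Prf T Γ (φ.iff ψ)) : Prf T Γ (ψ.iff φ) := andI h.andE₂ h.andE₁

theorem iff_trans {T : Set Fml} (h : Prf T Γ (φ.iff ψ)) (h' : Prf T Γ (ψ.iff χ)) :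
    Prf T Γ (φ.iff χ) :=
  andI (imp_trans h.andE₁ h'.andE₁) (imp_trans h'.andE₂ h.andE₂)

theorem neg_iterate_ex_imp {T : Set Fml} (n : ℕ) :
    Prf T Γ ((Fml.ex^[n] φ).neg.imp (Fml.all^[n] φ.neg)) := by
  induction n generalizing Γ with
  | zero => exact impI head
  | succ n ih =>
    rw [Function.iterate_succ_apply', Function.iterate_succ_apply']
    exact imp_trans neg_ex_imp (all_mono ih)

theorem iterate_all_mono {T : Set Fml} (n : ℕ) (h : Prf T [] (φ.imp ψ)) :
    Prf T [] ((Fml.all^[n] φ).imp (Fml.all^[n] ψ)) := by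
  induction n with
  | zero => exact h
  | succ n ih =>
    rw [Function.iterate_succ_apply', Function.iterate_succ_apply']
    exact all_mono ih

end Prf

/-- The two quantifiers, as operations on formulas. -/
inductive IsQuant : (Fml → Fml) → Prop
  | all : IsQuant .all
  | ex : IsQuant .ex

namespace IsQuant

variable {q : Fml → Fml}

theorem subst (hq : IsQuant q) (φ : Fml) (σ : ℕ → Tm) :
    (q φ).subst σ = q (φ.subst (up σ)) := by
  cases hq <;> rfl

theorem congr (hq : IsQuant q) {T : Set Fml} (h : Prf T (Γ.map Fml.shift) (φ.iff ψ)) :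
    Prf T Γ ((q φ).iff (q ψ)) := by
  cases hq with
  | all => exact .andI (.all_mono h.andE₁) (.all_mono h.andE₂)
  | ex => exact .andI (.ex_mono h.andE₁) (.ex_mono h.andE₂)

theorem dummy (hq : IsQuant q) {T : Set Fml} (φ : Fml) : Prf T Γ (φ.iff (q φ.shift)) := by
  cases hq with
  | all =>
    exact .andI (.impI (.allI .head)) (.impI (by
      have h : Prf T (Fml.all φ.shift :: Γ) (φ.shift.inst zeroT) := .allE zeroT .head
      rwa [φ.shift_inst] at h))
  | ex =>
    exact .andI (.impI (.exI zeroT ((φ.shift_inst zeroT).symm ▸ Prf.head)))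
      (.impI (.exE .head .head))

theorem iterate_subst (hq : IsQuant q) (n : ℕ) (φ : Fml) (σ : ℕ → Tm) :
    (q^[n] φ).subst σ = q^[n] (φ.subst (up^[n] σ)) := by
  induction n generalizing σ with
  | zero => rfl
  | succ n ih => rw [Function.iterate_succ_apply', hq.subst, ih, Function.iterate_succ_apply',
      Function.iterate_succ_apply]

theorem iterate_congr (hq : IsQuant q) {T : Set Fml} (n : ℕ)
    (h : Prf T ((List.map Fml.shift)^[n] Γ) (φ.iff ψ)) : Prf T Γ ((q^[n] φ).iff (q^[n] ψ)) := by
  induction n generalizing Γ with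
  | zero => exact h
  | succ n ih =>
    rw [Function.iterate_succ_apply', Function.iterate_succ_apply']
    exact hq.congr (ih h)

theorem iterate_congr_nil (hq : IsQuant q) {T : Set Fml} (n : ℕ) (h : Prf T [] (φ.iff ψ)) :
    Prf T Γ ((q^[n] φ).iff (q^[n] ψ)) :=
  hq.iterate_congr n h.lift

end IsQuant

/-! ### Prenex classes -/

/-- Formulas with a nonempty block of quantifiers `q` before a member of `S`. -/
def block (q : Fml → Fml) (S : Set Fml) : Set Fml := {φ | ∃ n : ℕ, 1 ≤ n ∧ ∃ ψ ∈ S, φ = q^[n] ψ}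

theorem sigmaSet_succ (k : ℕ) : sigmaSet (k + 1) = block .ex (piSet k) := by
  rw [sigmaSet, block]

theorem piSet_succ (k : ℕ) : piSet (k + 1) = block .all (sigmaSet k) := by
  rw [piSet, block]

/-- Both hierarchies arise from the quantifier-free formulas by prefixing blocks, so one argument
about `block` serves `Σ_k` and `Π_k` alike. -/
theorem prenex_induction {C : Set Fml → Prop} (h₀ : C {φ | φ.QF})
    (h : ∀ q S, IsQuant q → C S → C (block q S)) (k : ℕ) : C (sigmaSet k) ∧ C (piSet k) := by
  induction k with
  | zero => rw [sigmaSet, piSet]; exact ⟨h₀, h₀⟩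
  | succ k ih =>
    rw [sigmaSet_succ, piSet_succ]
    exact ⟨h _ _ .ex ih.2, h _ _ .all ih.1⟩

theorem Fml.QF.subst (h : φ.QF) (σ : ℕ → Tm) : (φ.subst σ).QF := by
  induction φ with
  | falsum => trivial
  | eq => trivial
  | and φ ψ ihφ ihψ => exact ⟨ihφ h.1, ihψ h.2⟩
  | or φ ψ ihφ ihψ => exact ⟨ihφ h.1, ihψ h.2⟩
  | imp φ ψ ihφ ihψ => exact ⟨ihφ h.1, ihψ h.2⟩
  | all => cases h
  | ex => cases h

/-- The set is closed under substitution. -/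
def SubstClosed (S : Set Fml) : Prop := ∀ φ ∈ S, ∀ σ, φ.subst σ ∈ S

theorem substClosed_prenex (k : ℕ) : SubstClosed (sigmaSet k) ∧ SubstClosed (piSet k) := by
  refine prenex_induction (fun φ h σ => Fml.QF.subst h σ) ?_ k
  rintro q S hq hS _ ⟨n, hn, ψ, hψ, rfl⟩ σ
  exact ⟨n, hn, _, hS ψ hψ _, hq.iterate_subst n ψ σ⟩

/-- Dummy quantifiers lengthen a block, so that two blocks of different lengths can be given a
common one. -/
theorem block_pad {q : Fml → Fml} (hq : IsQuant q) {S : Set Fml} (hS : SubstClosed S) (n m : ℕ)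
    (hφ : φ ∈ S) : ∃ ψ ∈ S, ∀ (T : Set Fml) Γ, Prf T Γ ((q^[n] φ).iff (q^[n + m] ψ)) := by
  induction m with
  | zero => exact ⟨φ, hφ, fun _ _ => .iff_refl _⟩
  | succ m ih =>
    obtain ⟨ψ, hψ, h⟩ := ih
    refine ⟨_, hS ψ hψ (up^[n + m] fun i => v (i + 1)), fun T Γ => (h T Γ).iff_trans ?_⟩
    rw [← add_assoc, Function.iterate_succ_apply', ← hq.iterate_subst]
    exact hq.dummy _

/-- The set is closed under definition by cases with a quantifier-free condition. -/
def CasesClosed (P : Principle) (S : Set Fml) : Prop :=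
  ∀ δ : Fml, δ.QF → ∀ φ ∈ S, ∀ ψ ∈ S, ∃ χ ∈ S,
    Prf (HAplus P) [δ] (φ.iff χ) ∧ Prf (HAplus P) [δ.neg] (ψ.iff χ)

theorem iterate_shift_qf {δ : Fml} (h : δ.QF) (n : ℕ) : (Fml.shift^[n] δ).QF := by
  induction n with
  | zero => exact h
  | succ n ih => rw [Function.iterate_succ_apply']; exact ih.subst _

theorem iterate_map_shift (n : ℕ) (δ : Fml) :
    (List.map Fml.shift)^[n] [δ] = [Fml.shift^[n] δ] := by
  induction n generalizing δ with
  | zero => rfl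
  | succ n ih => exact ih δ.shift

theorem iterate_shift_neg (n : ℕ) (δ : Fml) : Fml.shift^[n] δ.neg = (Fml.shift^[n] δ).neg := by
  induction n generalizing δ with
  | zero => rfl
  | succ n ih => exact ih δ.shift

open PF in
-- For a matrix, `(δ → φ) ∧ (¬δ → ψ)` works. For blocks, both prefixes are padded to the same length
-- and the case distinction is moved inside them, where `δ` is merely shifted.
theorem casesClosed_prenex (P : Principle) (k : ℕ) :
    CasesClosed P (sigmaSet k) ∧ CasesClosed P (piSet k) := by
  suffices h : (SubstClosed (sigmaSet k) ∧ CasesClosed P (sigmaSet k)) ∧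
      (SubstClosed (piSet k) ∧ CasesClosed P (piSet k)) from ⟨h.1.2, h.2.2⟩
  refine prenex_induction (C := fun S => SubstClosed S ∧ CasesClosed P S) ?_ ?_ k
  · refine ⟨fun φ h σ => Fml.QF.subst h σ, fun δ hδ φ hφ ψ hψ => ?_⟩
    refine ⟨.and (.imp δ φ) (.imp δ.neg ψ), ⟨⟨hδ, hφ⟩, ⟨⟨hδ, trivial⟩, hψ⟩⟩, ?_, ?_⟩
    · exact (Prf.taut [δ, φ, ψ] (0 ⇒ (1 ⇔ ((0 ⇒ 1) ⋏ (∼0 ⇒ 2)))) rfl).impE .head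
    · exact (Prf.taut [δ, φ, ψ] (∼0 ⇒ (2 ⇔ ((0 ⇒ 1) ⋏ (∼0 ⇒ 2)))) rfl).impE .head
  · rintro q S hq ⟨hS, hc⟩
    refine ⟨?_, ?_⟩
    · rintro _ ⟨n, hn, ψ, hψ, rfl⟩ σ
      exact ⟨n, hn, _, hS ψ hψ _, hq.iterate_subst n ψ σ⟩
    · rintro δ hδ _ ⟨n, hn, φ, hφ, rfl⟩ _ ⟨m, hm, ψ, hψ, rfl⟩
      obtain ⟨φ', hφ', h₁⟩ := block_pad hq hS n m hφ
      obtain ⟨ψ', hψ', h₂⟩ := block_pad hq hS m n hψ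
      rw [add_comm m n] at h₂
      obtain ⟨χ, hχ, h₃, h₄⟩ := hc _ (iterate_shift_qf hδ (n + m)) φ' hφ' ψ' hψ'
      rw [← iterate_map_shift] at h₃
      rw [← iterate_shift_neg, ← iterate_map_shift] at h₄
      exact ⟨_, ⟨n + m, by omega, χ, hχ, rfl⟩, (h₁ _ _).iff_trans (hq.iterate_congr _ h₃),
        (h₂ _ _).iff_trans (hq.iterate_congr _ h₄)⟩

open PF in
-- A disjunction is an existential statement about its own case: `∃ x`, with `φ` if `x = 0` and `ψ`
-- if `x ≠ 0`. Definition by cases makes the body a `Σ_{k+1}` formula, and `∃ x` joins its leading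
-- block. The witnesses are `0` and `1`.
theorem exists_sigma_iff_or (P : Principle) (k : ℕ) (hφ : φ ∈ sigmaSet k) (hψ : ψ ∈ sigmaSet k) :
    ∃ χ ∈ sigmaSet k, Prf (HAplus P) [] ((Fml.or φ ψ).iff χ) := by
  cases k with
  | zero =>
    rw [sigmaSet] at hφ hψ ⊢
    exact ⟨.or φ ψ, ⟨hφ, hψ⟩, .iff_refl _⟩
  | succ k =>
    obtain ⟨χ, hχ, h₁, h₂⟩ := (casesClosed_prenex P (k + 1)).1 (.eq (v 0) zeroT) trivial
      _ ((substClosed_prenex _).1 φ hφ fun i => v (i + 1))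
      _ ((substClosed_prenex _).1 ψ hψ fun i => v (i + 1))
    change Prf _ _ (φ.shift.iff χ) at h₁
    change Prf _ _ (ψ.shift.iff χ) at h₂
    refine ⟨.ex χ, ?_, .andI (.impI (.orE .head ?_ ?_)) (.impI (.exE .head ?_))⟩
    · rw [sigmaSet_succ] at hχ ⊢
      obtain ⟨n, hn, θ, hθ, rfl⟩ := hχ
      exact ⟨n + 1, by omega, θ, hθ, (Function.iterate_succ_apply' ..).symm⟩
    · have h := h₁.impI.inst (Γ := [φ, φ.or ψ]) zeroT
      simp only [Fml.inst, Fml.subst, zeroT_subst] at h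
      refine .exI zeroT (.impE (h.impE (.eqI _)).andE₁ ?_)
      exact (congrArg (Prf _ _) (φ.shift_inst zeroT)).mpr .head
    · have h := h₂.impI.inst (Γ := [ψ, φ.or ψ]) (succT zeroT)
      simp only [Fml.inst, Fml.subst, zeroT_subst] at h
      refine .exI (succT zeroT) (.impE (h.impE (.succ_ne_zero _)).andE₁ ?_)
      exact (congrArg (Prf _ _) (ψ.shift_inst (succT zeroT))).mpr .head
    · refine .orE (.eq_or_ne (v 0) zeroT) (.orI₁ ?_) (.orI₂ ?_)
      · exact .impE (h₁.impI.lift.impE .head).andE₂ (.tail .head)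
      · exact .impE (h₂.impI.lift.impE .head).andE₂ (.tail .head)

/-- The dummy quantifier is inserted directly before the matrix, so the leading quantifiers keep
their kind; `exists_pi_iff` instead puts one in front. -/
theorem exists_succ_iff (k : ℕ) :
    (∀ φ ∈ sigmaSet k, ∃ ψ ∈ sigmaSet (k + 1), ∀ T : Set Fml, Prf T [] (φ.iff ψ)) ∧
      ∀ φ ∈ piSet k, ∃ ψ ∈ piSet (k + 1), ∀ T : Set Fml, Prf T [] (φ.iff ψ) := by
  induction k with
  | zero =>
    rw [sigmaSet_succ, piSet_succ, sigmaSet, piSet]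
    exact ⟨fun φ h => ⟨_, ⟨1, le_rfl, _, h.subst _, rfl⟩, fun T => IsQuant.ex.dummy φ⟩,
      fun φ h => ⟨_, ⟨1, le_rfl, _, h.subst _, rfl⟩, fun T => IsQuant.all.dummy φ⟩⟩
  | succ k ih =>
    rw [sigmaSet_succ (k + 1), piSet_succ (k + 1), sigmaSet_succ k, piSet_succ k]
    constructor
    · rintro _ ⟨n, hn, φ, hφ, rfl⟩
      obtain ⟨ψ, hψ, h⟩ := ih.2 φ hφ
      exact ⟨_, ⟨n, hn, ψ, hψ, rfl⟩, fun T => IsQuant.ex.iterate_congr_nil n (h T)⟩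
    · rintro _ ⟨n, hn, φ, hφ, rfl⟩
      obtain ⟨ψ, hψ, h⟩ := ih.1 φ hφ
      exact ⟨_, ⟨n, hn, ψ, hψ, rfl⟩, fun T => IsQuant.all.iterate_congr_nil n (h T)⟩

theorem exists_pi_iff {k : ℕ} (hφ : φ ∈ sigmaSet k) :
    ∃ ψ ∈ piSet (k + 1), ∀ T : Set Fml, Prf T [] (φ.iff ψ) := by
  rw [piSet_succ]
  exact ⟨_, ⟨1, le_rfl, _, (substClosed_prenex k).1 φ hφ _, rfl⟩, fun T => IsQuant.all.dummy φ⟩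

theorem exists_iff_of_qf (hφ : φ.QF) (k : ℕ) :
    (∃ ψ ∈ sigmaSet k, ∀ T : Set Fml, Prf T [] (φ.iff ψ)) ∧
      ∃ ψ ∈ piSet k, ∀ T : Set Fml, Prf T [] (φ.iff ψ) := by
  induction k with
  | zero =>
    rw [sigmaSet, piSet]
    exact ⟨⟨φ, hφ, fun _ => .iff_refl _⟩, ⟨φ, hφ, fun _ => .iff_refl _⟩⟩
  | succ k ih =>
    obtain ⟨⟨ψ, hψ, h⟩, θ, hθ, h'⟩ := ih
    obtain ⟨ψ', hψ', h₁⟩ := (exists_succ_iff k).1 ψ hψ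
    obtain ⟨θ', hθ', h₂⟩ := (exists_succ_iff k).2 θ hθ
    exact ⟨⟨ψ', hψ', fun T => (h T).iff_trans (h₁ T)⟩, ⟨θ', hθ', fun T => (h' T).iff_trans (h₂ T)⟩⟩

/-! ### Duals -/

theorem Fml.dual_iterate_all (n : ℕ) (φ : Fml) : (Fml.all^[n] φ).dual = Fml.ex^[n] φ.dual := by
  induction n with
  | zero => rfl
  | succ n ih => rw [Function.iterate_succ_apply', Function.iterate_succ_apply', dual, ih]

theorem Fml.dual_iterate_ex (n : ℕ) (φ : Fml) : (Fml.ex^[n] φ).dual = Fml.all^[n] φ.dual := by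
  induction n with
  | zero => rfl
  | succ n ih => rw [Function.iterate_succ_apply', Function.iterate_succ_apply', dual, ih]

theorem Fml.QF.dual_eq (h : φ.QF) : φ.dual = φ.neg := by
  cases φ <;> first | rfl | cases h

theorem dual_mem (k : ℕ) :
    (∀ φ ∈ sigmaSet k, φ.dual ∈ piSet k) ∧ ∀ φ ∈ piSet k, φ.dual ∈ sigmaSet k := by
  induction k with
  | zero =>
    rw [sigmaSet, piSet]
    have h : ∀ φ : Fml, φ.QF → φ.dual.QF := fun φ h => h.dual_eq ▸ ⟨h, trivial⟩
    exact ⟨h, h⟩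
  | succ k ih =>
    rw [sigmaSet_succ, piSet_succ]
    constructor
    · rintro _ ⟨n, hn, φ, hφ, rfl⟩
      exact ⟨n, hn, _, ih.2 φ hφ, Fml.dual_iterate_ex n φ⟩
    · rintro _ ⟨n, hn, φ, hφ, rfl⟩
      exact ⟨n, hn, _, ih.1 φ hφ, Fml.dual_iterate_all n φ⟩

theorem dual_imp_neg (T : Set Fml) (φ : Fml) : Prf T [] (φ.dual.imp φ.neg) := by
  induction φ with
  | all φ ih => exact .imp_trans (.ex_mono ih) .ex_neg_imp
  | ex φ ih => exact .imp_trans (.all_mono ih) .all_neg_imp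
  | _ => exact .impI .head

open PF in
-- Dualizing twice restores the prefix and doubly negates the matrix, which is decidable.
theorem dual_dual_iff (P : Principle) (k : ℕ) :
    (∀ φ ∈ sigmaSet k, Prf (HAplus P) [] (φ.dual.dual.iff φ)) ∧
      ∀ φ ∈ piSet k, Prf (HAplus P) [] (φ.dual.dual.iff φ) := by
  induction k with
  | zero =>
    rw [sigmaSet, piSet]
    have h : ∀ φ : Fml, φ.QF → Prf (HAplus P) [] (φ.dual.dual.iff φ) := fun φ h => by
      rw [h.dual_eq]
      exact (Prf.taut [φ] ((0 ⋎ ∼0) ⇒ (∼∼0 ⇔ 0)) rfl).impE (.em_of_qf h)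
    exact ⟨h, h⟩
  | succ k ih =>
    rw [sigmaSet_succ, piSet_succ]
    constructor
    · rintro _ ⟨n, hn, φ, hφ, rfl⟩
      rw [Fml.dual_iterate_ex, Fml.dual_iterate_all]
      exact IsQuant.ex.iterate_congr_nil n (ih.2 φ hφ)
    · rintro _ ⟨n, hn, φ, hφ, rfl⟩
      rw [Fml.dual_iterate_all, Fml.dual_iterate_ex]
      exact IsQuant.all.iterate_congr_nil n (ih.1 φ hφ)

/-! ### Stability under double negation -/

/-- `HA + P` proves double negation elimination for all members of the set. -/
def Stable (P : Principle) (S : Set Fml) : Prop :=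
  ∀ φ ∈ S, Prf (HAplus P) [] (φ.neg.neg.imp φ)

/-- `HA + P` proves double negation elimination for `Σ_{k-1}`. -/
def StablePred (P : Principle) : ℕ → Prop
  | 0 => True
  | k + 1 => Stable P (sigmaSet k)

open PF in
theorem stable_of_iff (h : Prf (HAplus P) [] (φ.iff ψ)) (hψ : Prf (HAplus P) [] (ψ.neg.neg.imp ψ)) :
    Prf (HAplus P) [] (φ.neg.neg.imp φ) :=
  ((Prf.taut [φ, ψ] ((0 ⇔ 1) ⇒ (∼∼1 ⇒ 1) ⇒ ∼∼0 ⇒ 0) rfl).impE h).impE hψ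

theorem StablePred.of_sigma {k : ℕ} (h : Stable P (sigmaSet k)) : StablePred P k := by
  cases k with
  | zero => trivial
  | succ k =>
    intro φ hφ
    obtain ⟨ψ, hψ, hi⟩ := (exists_succ_iff k).1 φ hφ
    exact stable_of_iff (hi _) (h ψ hψ)

theorem StablePred.of_pi {k : ℕ} (h : Stable P (piSet k)) : StablePred P k := by
  cases k with
  | zero => trivial
  | succ k =>
    intro φ hφ
    obtain ⟨ψ, hψ, hi⟩ := exists_pi_iff hφ
    exact stable_of_iff (hi _) (h ψ hψ)

open PF in
-- For `∀ x⃗ φ` with `φ ∈ Σ_k`, the premise gives `∀ x⃗ ¬φ^⊥`. The induction hypothesis for `φ^⊥ ∈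
-- Π_k` yields `¬φ → φ^⊥`, hence `¬φ^⊥ → ¬¬φ`, and stability of `Σ_k` removes the double negation.
theorem StablePred.neg_dual_imp {k : ℕ} (h : StablePred P k) :
    ∀ φ ∈ piSet k, Prf (HAplus P) [] (φ.dual.neg.imp φ) := by
  induction k with
  | zero =>
    intro φ hφ
    rw [piSet] at hφ
    rw [Fml.QF.dual_eq hφ]
    exact (Prf.taut [φ] ((0 ⋎ ∼0) ⇒ ∼∼0 ⇒ 0) rfl).impE (.em_of_qf hφ)
  | succ k ih =>
    rw [piSet_succ]
    rintro _ ⟨n, hn, φ, hφ, rfl⟩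
    rw [Fml.dual_iterate_all]
    refine .imp_trans (.neg_iterate_ex_imp n) (.iterate_all_mono n ?_)
    have h₁ := ih (.of_sigma h) _ ((dual_mem k).1 φ hφ)
    exact (((Prf.taut [φ, φ.dual, φ.dual.dual]
      ((∼2 ⇒ 1) ⇒ (2 ⇔ 0) ⇒ (∼∼0 ⇒ 0) ⇒ ∼1 ⇒ 0) rfl).impE h₁).impE
      ((dual_dual_iff P k).1 φ hφ)).impE (h φ hφ)

open PF in
theorem StablePred.pi {k : ℕ} (h : StablePred P k) : Stable P (piSet k) := fun φ hφ =>
  ((Prf.taut [φ, φ.dual] ((1 ⇒ ∼0) ⇒ (∼1 ⇒ 0) ⇒ ∼∼0 ⇒ 0) rfl).impE (dual_imp_neg _ φ)).impE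
    (h.neg_dual_imp φ hφ)

open PF in
theorem StablePred.neg_iff_dual {k : ℕ} (h : StablePred P k) (hφ : φ ∈ sigmaSet k) :
    Prf (HAplus P) [] (φ.neg.iff φ.dual) :=
  (((Prf.taut [φ, φ.dual, φ.dual.dual]
    ((1 ⇒ ∼0) ⇒ (∼2 ⇒ 1) ⇒ (2 ⇔ 0) ⇒ (∼0 ⇔ 1)) rfl).impE (dual_imp_neg _ φ)).impE
    (h.neg_dual_imp _ ((dual_mem k).1 φ hφ))).impE ((dual_dual_iff P k).1 φ hφ)

open PF in
-- One level more stability is assumed than in `StablePred.neg_iff_dual`: `¬φ` gives `¬¬φ^⊥` with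
-- `φ^⊥ ∈ Σ_k`, and this must be eliminated.
theorem neg_iff_dual_of_stable {k : ℕ} (h : Stable P (sigmaSet k)) (hφ : φ ∈ piSet k) :
    Prf (HAplus P) [] (φ.neg.iff φ.dual) :=
  (((Prf.taut [φ, φ.dual] ((1 ⇒ ∼0) ⇒ (∼1 ⇒ 0) ⇒ (∼∼1 ⇒ 1) ⇒ (∼0 ⇔ 1)) rfl).impE
    (dual_imp_neg _ φ)).impE ((StablePred.of_sigma h).neg_dual_imp φ hφ)).impE
    (h _ ((dual_mem k).2 φ hφ))

/-! ### Classes with premises -/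

/-- The premise of a member of a class, trivial if there is none. -/
def GFml.pre (a : GFml) : Fml := a.premise.getD Fml.falsum.neg

/-- The conjunction of two premises. -/
def preAnd (a b : GFml) : Fml := .and a.pre b.pre

section
open PF

/-- Replacing an absent premise by `⊥ → ⊥` lets later arguments treat classes with and without
premises uniformly. -/
theorem prf_guarded_iff {T : Set Fml} (a : GFml) :
    Prf T Γ (guarded a.premise χ) ↔ Prf T Γ (a.pre.imp χ) := by
  obtain ⟨_ | p, φ⟩ := a
  · exact ⟨fun h => (Prf.taut [χ] (0 ⇒ ∼.bot ⇒ 0) rfl).impE h,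
      fun h => (Prf.taut [χ] ((∼.bot ⇒ 0) ⇒ 0) rfl).impE h⟩
  · rfl

theorem prf_guarded_merge_iff {T : Set Fml} (a b : GFml) :
    Prf T Γ (guarded (Option.merge Fml.and a.premise b.premise) χ) ↔
      Prf T Γ ((preAnd a b).imp χ) := by
  obtain ⟨_ | p, φ⟩ := a <;> obtain ⟨_ | q, ψ⟩ := b
  · exact ⟨fun h => (Prf.taut [χ] (0 ⇒ (∼.bot ⋏ ∼.bot) ⇒ 0) rfl).impE h,
      fun h => (Prf.taut [χ] (((∼.bot ⋏ ∼.bot) ⇒ 0) ⇒ 0) rfl).impE h⟩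
  · exact ⟨fun h => (Prf.taut [χ, q] ((1 ⇒ 0) ⇒ (∼.bot ⋏ 1) ⇒ 0) rfl).impE h,
      fun h => (Prf.taut [χ, q] (((∼.bot ⋏ 1) ⇒ 0) ⇒ 1 ⇒ 0) rfl).impE h⟩
  · exact ⟨fun h => (Prf.taut [χ, p] ((1 ⇒ 0) ⇒ (1 ⋏ ∼.bot) ⇒ 0) rfl).impE h,
      fun h => (Prf.taut [χ, p] (((1 ⋏ ∼.bot) ⇒ 0) ⇒ 1 ⇒ 0) rfl).impE h⟩
  · rfl

variable {C D E C' D' : Cls} {k : ℕ}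

-- Derivability of the schemata, instance by instance

theorem derives_lem_iff : Derives P (LEM C) ↔
    ∀ a ∈ C, Prf (HAplus P) [] (a.pre.imp (.or a.fml a.fml.neg)) := by
  constructor
  · exact fun h a ha => (prf_guarded_iff a).1 (h _ ⟨a, ha, rfl⟩)
  · rintro h _ ⟨a, ha, rfl⟩
    exact (prf_guarded_iff a).2 (h a ha)

theorem derives_dne_iff : Derives P (DNE C) ↔
    ∀ a ∈ C, Prf (HAplus P) [] (a.pre.imp (a.fml.neg.neg.imp a.fml)) := by
  constructor
  · exact fun h a ha => (prf_guarded_iff a).1 (h _ ⟨a, ha, rfl⟩)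
  · rintro h _ ⟨a, ha, rfl⟩
    exact (prf_guarded_iff a).2 (h a ha)

theorem derives_dne_or_iff : Derives P (DNE (C.or D)) ↔
    ∀ a ∈ C, ∀ b ∈ D, Prf (HAplus P) []
      ((preAnd a b).imp ((Fml.or a.fml b.fml).neg.neg.imp (.or a.fml b.fml))) := by
  constructor
  · exact fun h a ha b hb => (prf_guarded_merge_iff a b).1 (h _ ⟨_, ⟨a, ha, b, hb, rfl⟩, rfl⟩)
  · rintro h _ ⟨_, ⟨a, ha, b, hb, rfl⟩, rfl⟩
    exact (prf_guarded_merge_iff a b).2 (h a ha b hb)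

theorem derives_dml_iff : Derives P (DML C) ↔
    ∀ a ∈ C, ∀ b ∈ C, Prf (HAplus P) []
      ((preAnd a b).imp ((Fml.and a.fml b.fml).neg.imp (.or a.fml.neg b.fml.neg))) := by
  constructor
  · exact fun h a ha b hb => (prf_guarded_merge_iff a b).1 (h _ ⟨a, ha, b, hb, rfl⟩)
  · rintro h _ ⟨a, ha, b, hb, rfl⟩
    exact (prf_guarded_merge_iff a b).2 (h a ha b hb)

theorem derives_dmlDual_iff : Derives P (DMLDual (SigmaC k)) ↔
    ∀ φ ∈ sigmaSet k, ∀ ψ ∈ sigmaSet k,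
      Prf (HAplus P) [] ((Fml.and φ ψ).neg.imp (.or φ.dual ψ.dual)) := by
  constructor
  · exact fun h φ hφ ψ hψ => h _ ⟨⟨none, φ⟩, ⟨rfl, hφ⟩, ⟨none, ψ⟩, ⟨rfl, hψ⟩, rfl⟩
  · rintro h _ ⟨⟨_, φ⟩, ⟨rfl, hφ⟩, ⟨_, ψ⟩, ⟨rfl, hψ⟩, rfl⟩
    exact h φ hφ ψ hψ

theorem derives_dne_ofSet_iff {S : Set Fml} : Derives P (DNE (Cls.ofSet S)) ↔ Stable P S := by
  constructor
  · exact fun h φ hφ => h _ ⟨⟨none, φ⟩, ⟨rfl, hφ⟩, rfl⟩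
  · rintro h _ ⟨⟨_, φ⟩, ⟨rfl, hφ⟩, rfl⟩
    exact h φ hφ

theorem derives_dne_sigmaPred_iff : Derives P (DNE (SigmaPredC k)) ↔ StablePred P k := by
  cases k with
  | zero => exact iff_of_true (by rintro _ ⟨_, h, _⟩; exact h.elim) trivial
  | succ k => exact derives_dne_ofSet_iff

theorem derives_union_iff : Derives P (Q ∪ R) ↔ Derives P Q ∧ Derives P R :=
  ⟨fun h => ⟨fun φ hφ => h φ (.inl hφ), fun φ hφ => h φ (.inr hφ)⟩,
    fun h φ hφ => hφ.elim (h.1 φ) (h.2 φ)⟩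

/-- Every member of `C` is, under its premise, equivalent over `HA + P` to a member of `D`. -/
def Reduces (P : Principle) (C D : Cls) : Prop :=
  ∀ a ∈ C, ∃ b ∈ D, Prf (HAplus P) [] (a.pre.imp b.pre) ∧
    Prf (HAplus P) [] (a.pre.imp (a.fml.iff b.fml))

theorem Reduces.refl (C : Cls) : Reduces P C C := fun a ha =>
  ⟨a, ha, .impI .head, .impI (.iff_refl _)⟩

theorem Reduces.trans (h : Reduces P C D) (h' : Reduces P D E) : Reduces P C E := by
  intro a ha
  obtain ⟨b, hb, h₁, h₂⟩ := h a ha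
  obtain ⟨c, hc, h₃, h₄⟩ := h' b hb
  exact ⟨c, hc, h₁.imp_trans h₃, .impI (h₂.tail.impE .head |>.iff_trans <|
    (h₁.imp_trans h₄).tail.impE .head)⟩

theorem Reduces.neg (h : Reduces P C D) : Reduces P C.neg D.neg := by
  rintro _ ⟨a, ha, rfl⟩
  obtain ⟨b, hb, h₁, h₂⟩ := h a ha
  exact ⟨_, ⟨b, hb, rfl⟩, h₁,
    (Prf.taut [a.pre, a.fml, b.fml] ((0 ⇒ (1 ⇔ 2)) ⇒ 0 ⇒ (∼1 ⇔ ∼2)) rfl).impE h₂⟩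

theorem Reduces.dn (h : Reduces P C D) : Reduces P C.dn D.dn := h.neg.neg

/-- The exchange principle: `DNE` is invariant under provable equivalence, and the premises of the
replaced instance imply those of the one applied. -/
theorem Reduces.dne_or (hC : Reduces P C C') (hD : Reduces P D D')
    (h : Derives P (DNE (C'.or D'))) : Derives P (DNE (C.or D)) := by
  rw [derives_dne_or_iff] at h ⊢
  intro a ha b hb
  obtain ⟨a', ha', h₁, h₂⟩ := hC a ha
  obtain ⟨b', hb', h₃, h₄⟩ := hD b hb
  have ha : Prf (HAplus P) [preAnd a b] a.pre := .andE₁ .head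
  have hb : Prf (HAplus P) [preAnd a b] b.pre := .andE₂ .head
  exact .impI <| (((Prf.taut [a.fml, b.fml, a'.fml, b'.fml]
    ((0 ⇔ 2) ⇒ (1 ⇔ 3) ⇒ (∼∼(2 ⋎ 3) ⇒ (2 ⋎ 3)) ⇒ ∼∼(0 ⋎ 1) ⇒ (0 ⋎ 1)) rfl).impE
    (h₂.lift.impE ha)).impE (h₄.lift.impE hb)).impE
    ((h a' ha' b' hb').lift.impE (.andI (h₁.lift.impE ha) (h₃.lift.impE hb)))

theorem Reduces.dne (hC : Reduces P C D) (h : Derives P (DNE D)) : Derives P (DNE C) := by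
  rw [derives_dne_iff] at h ⊢
  intro a ha
  obtain ⟨b, hb, h₁, h₂⟩ := hC a ha
  exact (((Prf.taut [a.pre, a.fml, b.pre, b.fml]
    ((0 ⇒ 2) ⇒ (0 ⇒ (1 ⇔ 3)) ⇒ (2 ⇒ ∼∼3 ⇒ 3) ⇒ 0 ⇒ ∼∼1 ⇒ 1) rfl).impE h₁).impE h₂).impE (h b hb)

-- Excluded middle against double negation elimination

theorem lem_neg (h : Derives P (LEM C)) : Derives P (LEM C.neg) := by
  rw [derives_lem_iff] at h ⊢
  rintro _ ⟨a, ha, rfl⟩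
  exact (Prf.taut [a.pre, a.fml] ((0 ⇒ (1 ⋎ ∼1)) ⇒ 0 ⇒ (∼1 ⋎ ∼∼1)) rfl).impE (h a ha)

theorem dne_of_lem (h : Derives P (LEM C)) : Derives P (DNE C) := by
  rw [derives_lem_iff] at h
  rw [derives_dne_iff]
  intro a ha
  exact (Prf.taut [a.pre, a.fml] ((0 ⇒ (1 ⋎ ∼1)) ⇒ 0 ⇒ ∼∼1 ⇒ 1) rfl).impE (h a ha)

theorem dne_neg : Derives P (DNE C.neg) := by
  rw [derives_dne_iff]
  rintro _ ⟨a, ha, rfl⟩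
  exact Prf.taut [a.pre, a.fml] (0 ⇒ ∼∼∼1 ⇒ ∼1) rfl

/-- Decide the first disjunct; if it fails, `¬¬(φ ∨ ψ)` gives `¬¬ψ`. -/
theorem dne_or_of_lem (h : Derives P (LEM C)) (h' : Derives P (DNE D)) :
    Derives P (DNE (C.or D)) := by
  rw [derives_lem_iff] at h
  rw [derives_dne_iff] at h'
  rw [derives_dne_or_iff]
  intro a ha b hb
  exact ((Prf.taut [a.pre, a.fml, b.pre, b.fml]
    ((0 ⇒ (1 ⋎ ∼1)) ⇒ (2 ⇒ ∼∼3 ⇒ 3) ⇒ (0 ⋏ 2) ⇒ ∼∼(1 ⋎ 3) ⇒ (1 ⋎ 3)) rfl).impE (h a ha)).impE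
    (h' b hb)

/-- `¬¬(φ ∨ ¬φ)` is an intuitionistic tautology. The same member is used in both disjuncts, so the
two premises coincide. -/
theorem lem_of_dne_or_neg (h : Derives P (DNE (C.or C.neg))) : Derives P (LEM C) := by
  rw [derives_dne_or_iff] at h
  rw [derives_lem_iff]
  intro a ha
  exact (Prf.taut [a.pre, a.fml]
    (((0 ⋏ 0) ⇒ ∼∼(1 ⋎ ∼1) ⇒ (1 ⋎ ∼1)) ⇒ 0 ⇒ (1 ⋎ ∼1)) rfl).impE (h a ha _ ⟨a, ha, rfl⟩)

theorem dne_or_comm (h : Derives P (DNE (C.or D))) : Derives P (DNE (D.or C)) := by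
  rw [derives_dne_or_iff] at h ⊢
  intro a ha b hb
  exact (Prf.taut [a.pre, a.fml, b.pre, b.fml]
    (((2 ⋏ 0) ⇒ ∼∼(3 ⋎ 1) ⇒ (3 ⋎ 1)) ⇒ (0 ⋏ 2) ⇒ ∼∼(1 ⋎ 3) ⇒ (1 ⋎ 3)) rfl).impE (h b hb a ha)

/-- The class has a provable member. -/
def HasTrue (C : Cls) : Prop :=
  ∃ a ∈ C, ∀ P : Principle, Prf (HAplus P) [] a.pre ∧ Prf (HAplus P) [] a.fml

/-- The class has a refutable member. -/
def HasFalse (C : Cls) : Prop :=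
  ∃ a ∈ C, ∀ P : Principle, Prf (HAplus P) [] a.pre ∧ Prf (HAplus P) [] a.fml.neg

theorem HasTrue.neg (h : HasTrue C) : HasFalse C.neg := by
  obtain ⟨a, ha, h⟩ := h
  exact ⟨_, ⟨a, ha, rfl⟩, fun P => ⟨(h P).1, (Prf.taut [a.fml] (0 ⇒ ∼∼0) rfl).impE (h P).2⟩⟩

theorem HasFalse.neg (h : HasFalse C) : HasTrue C.neg := by
  obtain ⟨a, ha, h⟩ := h
  exact ⟨_, ⟨a, ha, rfl⟩, h⟩

/-- With a refutable second disjunct the disjunction is equivalent to the first. This is how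
stability is extracted from every principle about disjunctions. -/
theorem HasFalse.dne (hD : HasFalse D) (h : Derives P (DNE (C.or D))) : Derives P (DNE C) := by
  rw [derives_dne_or_iff] at h
  rw [derives_dne_iff]
  obtain ⟨b, hb, hf⟩ := hD
  intro a ha
  exact (((Prf.taut [a.pre, a.fml, b.pre, b.fml]
    (((0 ⋏ 2) ⇒ ∼∼(1 ⋎ 3) ⇒ (1 ⋎ 3)) ⇒ 2 ⇒ ∼3 ⇒ 0 ⇒ ∼∼1 ⇒ 1) rfl).impE (h a ha b hb)).impE
    (hf P).1).impE (hf P).2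

-- The concrete classes: trivial members and mutual reductions

theorem hasFalse_sigma (k : ℕ) : HasFalse (SigmaC k) := by
  obtain ⟨φ, hφ, h⟩ := (exists_iff_of_qf (φ := .falsum) trivial k).1
  exact ⟨⟨none, φ⟩, ⟨rfl, hφ⟩, fun P => ⟨.impI .head, (h _).andE₂⟩⟩

theorem hasFalse_pi (k : ℕ) : HasFalse (PiC k) := by
  obtain ⟨φ, hφ, h⟩ := (exists_iff_of_qf (φ := .falsum) trivial k).2
  exact ⟨⟨none, φ⟩, ⟨rfl, hφ⟩, fun P => ⟨.impI .head, (h _).andE₂⟩⟩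

theorem hasTrue_sigma (k : ℕ) : HasTrue (SigmaC k) := by
  obtain ⟨φ, hφ, h⟩ := (exists_iff_of_qf (φ := Fml.falsum.neg) ⟨trivial, trivial⟩ k).1
  exact ⟨⟨none, φ⟩, ⟨rfl, hφ⟩, fun P => ⟨.impI .head, (h _).andE₁.impE (.impI .head)⟩⟩

theorem hasTrue_pi (k : ℕ) : HasTrue (PiC k) := by
  obtain ⟨φ, hφ, h⟩ := (exists_iff_of_qf (φ := Fml.falsum.neg) ⟨trivial, trivial⟩ k).2
  exact ⟨⟨none, φ⟩, ⟨rfl, hφ⟩, fun P => ⟨.impI .head, (h _).andE₁.impE (.impI .head)⟩⟩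

theorem hasFalse_delta (k : ℕ) : HasFalse (DeltaC k) := by
  obtain ⟨⟨φ, hφ, h⟩, ψ, hψ, h'⟩ := exists_iff_of_qf (φ := .falsum) trivial k
  exact ⟨_, ⟨φ, hφ, ψ, hψ, rfl⟩, fun P => ⟨(h _).iff_symm.iff_trans (h' _), (h _).andE₂⟩⟩

theorem hasTrue_delta (k : ℕ) : HasTrue (DeltaC k) := by
  obtain ⟨⟨φ, hφ, h⟩, ψ, hψ, h'⟩ :=
    exists_iff_of_qf (φ := Fml.falsum.neg) ⟨trivial, trivial⟩ k
  exact ⟨_, ⟨φ, hφ, ψ, hψ, rfl⟩, fun P =>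
    ⟨(h _).iff_symm.iff_trans (h' _), (h _).andE₁.impE (.impI .head)⟩⟩

theorem reduces_delta_sigma : Reduces P (DeltaC k) (SigmaC k) := by
  rintro _ ⟨φ, hφ, ψ, hψ, rfl⟩
  exact ⟨⟨none, φ⟩, ⟨rfl, hφ⟩, .impI (.impI .head), .impI (.iff_refl _)⟩

theorem reduces_delta_pi : Reduces P (DeltaC k) (PiC k) := by
  rintro _ ⟨φ, hφ, ψ, hψ, rfl⟩
  exact ⟨⟨none, ψ⟩, ⟨rfl, hψ⟩, .impI (.impI .head), .impI .head⟩

/-- A formula of `Σ_k` is equivalent both to a `Σ_{k+1}` and to a `Π_{k+1}` formula, so the premise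
attached to it is provable. -/
theorem reduces_sigmaPred_delta : Reduces P (SigmaPredC k) (DeltaC k) := by
  cases k with
  | zero => intro a ha; exact ha.elim
  | succ k =>
    rintro ⟨_, φ⟩ ⟨rfl, hφ⟩
    obtain ⟨ψ, hψ, h⟩ := (exists_succ_iff k).1 φ hφ
    obtain ⟨χ, hχ, h'⟩ := exists_pi_iff hφ
    exact ⟨_, ⟨ψ, hψ, χ, hχ, rfl⟩, .impI ((h _).iff_symm.iff_trans (h' _)).tail,
      .impI (h _).tail⟩

theorem reduces_dn_of_dne (h : Derives P (DNE C)) : Reduces P C.dn C ∧ Reduces P C C.dn := by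
  rw [derives_dne_iff] at h
  constructor
  · rintro _ ⟨_, ⟨a, ha, rfl⟩, rfl⟩
    exact ⟨a, ha, .impI .head, (Prf.taut [a.pre, a.fml]
      ((0 ⇒ ∼∼1 ⇒ 1) ⇒ 0 ⇒ (∼∼1 ⇔ 1)) rfl).impE (h a ha)⟩
  · intro a ha
    exact ⟨_, ⟨_, ⟨a, ha, rfl⟩, rfl⟩, .impI .head, (Prf.taut [a.pre, a.fml]
      ((0 ⇒ ∼∼1 ⇒ 1) ⇒ 0 ⇒ (1 ⇔ ∼∼1)) rfl).impE (h a ha)⟩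

theorem StablePred.dne_pi (h : StablePred P k) : Derives P (DNE (PiC k)) :=
  derives_dne_ofSet_iff.2 h.pi

theorem StablePred.neg_sigma_pi (h : StablePred P k) : Reduces P (SigmaC k).neg (PiC k) := by
  rintro _ ⟨⟨_, φ⟩, ⟨rfl, hφ⟩, rfl⟩
  exact ⟨⟨none, φ.dual⟩, ⟨rfl, (dual_mem k).1 φ hφ⟩, .impI .head, .impI (h.neg_iff_dual hφ).tail⟩

theorem StablePred.pi_neg_sigma (h : StablePred P k) : Reduces P (PiC k) (SigmaC k).neg := by
  rintro ⟨_, φ⟩ ⟨rfl, hφ⟩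
  have hd := (dual_mem k).2 φ hφ
  exact ⟨_, ⟨⟨none, φ.dual⟩, ⟨rfl, hd⟩, rfl⟩, .impI .head,
    .impI (((dual_dual_iff P k).2 φ hφ).iff_symm.iff_trans (h.neg_iff_dual hd).iff_symm).tail⟩

theorem reduces_neg_pi_sigma (h : Derives P (DNE (SigmaC k))) :
    Reduces P (PiC k).neg (SigmaC k) := by
  rintro _ ⟨⟨_, φ⟩, ⟨rfl, hφ⟩, rfl⟩
  exact ⟨⟨none, φ.dual⟩, ⟨rfl, (dual_mem k).2 φ hφ⟩, .impI .head,
    .impI (neg_iff_dual_of_stable (derives_dne_ofSet_iff.1 h) hφ).tail⟩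

theorem StablePred.of_dne_sigma (h : Derives P (DNE (SigmaC k))) : StablePred P k :=
  .of_sigma (derives_dne_ofSet_iff.1 h)

theorem StablePred.of_dne_pi (h : Derives P (DNE (PiC k))) : StablePred P k :=
  .of_pi (derives_dne_ofSet_iff.1 h)

theorem StablePred.of_dne_delta (h : Derives P (DNE (DeltaC k))) : StablePred P k :=
  derives_dne_sigmaPred_iff.1 (reduces_sigmaPred_delta.dne h)

theorem StablePred.dne_delta (h : StablePred P k) : Derives P (DNE (DeltaC k)) :=
  reduces_delta_pi.dne h.dne_pi

theorem dne_sigma_or_sigma (h : Derives P (DNE (SigmaC k))) :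
    Derives P (DNE ((SigmaC k).or (SigmaC k))) := by
  rw [derives_dne_or_iff]
  rintro ⟨_, φ⟩ ⟨rfl, hφ⟩ ⟨_, ψ⟩ ⟨rfl, hψ⟩
  obtain ⟨χ, hχ, hi⟩ := exists_sigma_iff_or P k hφ hψ
  exact .impI (stable_of_iff hi (derives_dne_ofSet_iff.1 h χ hχ)).tail

/-! ### The equivalences -/

/-- Comparing everything with the head of the list suffices, by symmetry and transitivity. -/
theorem pairwise_equivHA {P : Principle} {L : List Principle} (h : ∀ Q ∈ L, EquivHA P Q) :
    List.Pairwise EquivHA (P :: L) := by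
  refine List.pairwise_cons.2 ⟨h, ?_⟩
  exact List.pairwise_iff_forall_sublist.2 fun hs =>
    (h _ (hs.subset (by simp))).symm.trans (h _ (hs.subset (by simp)))

theorem dne_sigma_or_iff {C : Cls} (hC : HasFalse C)
    (h : ∀ {P}, Derives P (DNE (SigmaC k)) → Reduces P C (SigmaC k)) :
    EquivHA (DNE ((SigmaC k).or C)) (DNE (SigmaC k)) :=
  ⟨hC.dne (.refl _), (h (.refl _)) |> (Reduces.refl _).dne_or <| dne_sigma_or_sigma (.refl _)⟩

/-- Each reduction may use the principle from which one starts; this is why the hypotheses range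
over all `P`. -/
theorem dne_or_congr {C C' D D' : Cls}
    (h : ∀ {P}, Derives P (DNE (C.or D)) → Reduces P C' C ∧ Reduces P D' D)
    (h' : ∀ {P}, Derives P (DNE (C'.or D')) → Reduces P C C' ∧ Reduces P D D') :
    EquivHA (DNE (C.or D)) (DNE (C'.or D')) :=
  ⟨(h (.refl _)).1.dne_or (h (.refl _)).2 (.refl _),
    (h' (.refl _)).1.dne_or (h' (.refl _)).2 (.refl _)⟩

/-- Forwards, the law is applied to the duals: `¬¬(φ ∨ ψ)` implies `¬(φ^⊥ ∧ ψ^⊥)`. Backwards, `DNE`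
yields stability of `Π_k`, hence `¬φ ↔ φ^⊥` on `Σ_k`, and `¬(φ ∧ ψ)` becomes `¬¬(φ^⊥ ∨ ψ^⊥)`. -/
theorem dmlDual_equiv : EquivHA (DMLDual (SigmaC k)) (DNE ((PiC k).or (PiC k))) := by
  constructor
  · rw [derives_dne_or_iff]
    rintro ⟨_, φ⟩ ⟨rfl, hφ⟩ ⟨_, ψ⟩ ⟨rfl, hψ⟩
    have h := derives_dmlDual_iff.1 (.refl (DMLDual (SigmaC k))) _ ((dual_mem k).2 φ hφ) _ ((dual_mem k).2 ψ hψ)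
    exact .impI (((((((Prf.taut [φ, φ.dual, φ.dual.dual, ψ, ψ.dual, ψ.dual.dual]
      ((∼(1 ⋏ 4) ⇒ (2 ⋎ 5)) ⇒ (1 ⇒ ∼0) ⇒ (4 ⇒ ∼3) ⇒ (2 ⇔ 0) ⇒ (5 ⇔ 3) ⇒
        ∼∼(0 ⋎ 3) ⇒ (0 ⋎ 3)) rfl).impE h).impE (dual_imp_neg _ φ)).impE (dual_imp_neg _ ψ)).impE
      ((dual_dual_iff _ k).2 φ hφ)).impE ((dual_dual_iff _ k).2 ψ hψ))).tail
  · rw [derives_dmlDual_iff]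
    intro φ hφ ψ hψ
    have hs : StablePred (DNE ((PiC k).or (PiC k))) k :=
      .of_dne_pi ((hasFalse_pi k).dne (.refl _))
    have h := derives_dne_or_iff.1 (.refl (DNE ((PiC k).or (PiC k)))) ⟨none, φ.dual⟩ ⟨rfl, (dual_mem k).1 φ hφ⟩
      ⟨none, ψ.dual⟩ ⟨rfl, (dual_mem k).1 ψ hψ⟩
    exact ((((Prf.taut [φ, φ.dual, ψ, ψ.dual]
      -- The conjunction `∼.bot ⋏ ∼.bot` is what `preAnd` becomes when neither member has a premise.
      (((∼.bot ⋏ ∼.bot) ⇒ ∼∼(1 ⋎ 3) ⇒ (1 ⋎ 3)) ⇒ (∼0 ⇔ 1) ⇒ (∼2 ⇔ 3) ⇒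
        ∼(0 ⋏ 2) ⇒ (1 ⋎ 3)) rfl).impE h).impE (hs.neg_iff_dual hφ)).impE (hs.neg_iff_dual hψ))

theorem dml_of_dne_or (h : Derives P (DNE (C.or C))) : Derives P (DML C.neg) := by
  rw [derives_dne_or_iff] at h
  rw [derives_dml_iff]
  rintro _ ⟨a, ha, rfl⟩ _ ⟨b, hb, rfl⟩
  exact (Prf.taut [a.pre, a.fml, b.pre, b.fml]
    (((0 ⋏ 2) ⇒ ∼∼(1 ⋎ 3) ⇒ (1 ⋎ 3)) ⇒ (0 ⋏ 2) ⇒ ∼(∼1 ⋏ ∼3) ⇒ (∼∼1 ⋎ ∼∼3)) rfl).impE (h a ha b hb)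

theorem dne_or_of_dml (h : Derives P (DML C.neg)) (h' : Derives P (DNE C)) :
    Derives P (DNE (C.or C)) := by
  rw [derives_dml_iff] at h
  rw [derives_dne_iff] at h'
  rw [derives_dne_or_iff]
  intro a ha b hb
  exact .impI <| (((Prf.taut [a.fml, b.fml]
    ((∼(∼0 ⋏ ∼1) ⇒ (∼∼0 ⋎ ∼∼1)) ⇒ (∼∼0 ⇒ 0) ⇒ (∼∼1 ⇒ 1) ⇒ ∼∼(0 ⋎ 1) ⇒ (0 ⋎ 1)) rfl).impE
    ((h _ ⟨a, ha, rfl⟩ _ ⟨b, hb, rfl⟩).lift.impE .head)).impE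
    ((h' a ha).lift.impE (.andE₁ .head))).impE ((h' b hb).lift.impE (.andE₂ .head))

/-- A refutable member of `C.neg` leaves `DNE` of `Δ_k`, hence of `Σ_{k-1}`; that suffices to read
`¬Δ_k` inside `C.neg`, which gives `DNE` of `Δ_k ∨ ¬Δ_k`. -/
theorem lem_delta_equiv_left {C : Cls} (hC : HasFalse C.neg)
    (h : ∀ {P}, StablePred P k → Reduces P (DeltaC k).neg C.neg) :
    EquivHA (LEM (DeltaC k)) (DNE ((DeltaC k).or C.neg)) := by
  refine ⟨dne_or_of_lem (.refl _) dne_neg, lem_of_dne_or_neg ?_⟩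
  exact (Reduces.refl _).dne_or (h (.of_dne_delta (hC.dne (.refl _)))) (.refl _)

theorem lem_delta_equiv_right {C : Cls} (hC : HasFalse C)
    (h : ∀ {P}, Derives P (LEM (DeltaC k)) → Derives P (LEM C))
    (h' : ∀ {P}, StablePred P k → Derives P (DNE (C.or (PiC k))) → Derives P (LEM (DeltaC k))) :
    EquivHA (LEM (DeltaC k)) (DNE (C.or (PiC k))) :=
  ⟨dne_or_of_lem (h (.refl _)) (StablePred.of_dne_delta (dne_of_lem (.refl _))).dne_pi,
    h' (.of_dne_pi (hC.dne (dne_or_comm (.refl _)))) (.refl _)⟩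

/-- The negation of the `Σ_k` formula is its dual, a `Π_k` formula. -/
theorem lem_delta_of_dne_or_pi (hs : StablePred P k) (h : Derives P (DNE ((DeltaC k).or (PiC k)))) :
    Derives P (LEM (DeltaC k)) :=
  lem_of_dne_or_neg ((Reduces.refl _).dne_or (reduces_delta_sigma.neg.trans hs.neg_sigma_pi) h)

end

end HeytingArith

open HeytingArith
theorem mainTheorem10 (k : ℕ) :
    (∀ Γ' ∈ ({SigmaC k, DeltaC k, (PiC k).neg, (DeltaC k).neg, (SigmaC k).dn, (DeltaC k).dn} :
        Set Cls), EquivHA (DNE ((SigmaC k).or Γ')) (DNE (SigmaC k))) ∧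
    List.Pairwise EquivHA
      [LEM (SigmaC k), DNE ((SigmaC k).or (PiC k)), DNE ((SigmaC k).or (SigmaC k).neg),
        DNE ((SigmaC k).or (PiC k).dn)] ∧
    List.Pairwise EquivHA
      [LEM (PiC k), DNE ((PiC k).neg.or (PiC k)), DNE ((SigmaC k).dn.or (PiC k))] ∧
    List.Pairwise EquivHA
      [DMLDual (SigmaC k), DNE ((PiC k).or (PiC k)), DNE ((PiC k).or (SigmaC k).neg),
        DNE ((PiC k).or (PiC k).dn)] ∧
    (∀ Γ' ∈ ({SigmaC k, PiC k, DeltaC k, (SigmaC k).neg, (PiC k).neg} : Set Cls),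
      ∀ Γ'' ∈ ({DeltaC k, (DeltaC k).neg, (DeltaC k).dn} : Set Cls),
        List.Pairwise EquivHA
          [LEM (DeltaC k), DNE ((DeltaC k).or Γ'.neg), DNE (Γ''.or (PiC k))]) ∧
    List.Pairwise EquivHA
      [DNE ((DeltaC k).or (DeltaC k)), DNE ((DeltaC k).or (DeltaC k).dn),
        DML (DeltaC k).neg ∪ DNE (SigmaPredC k)] := by
  refine ⟨?_, ?_, ?_, ?_, ?_, ?_⟩
  · rintro C (rfl | rfl | rfl | rfl | rfl | rfl)
    · exact dne_sigma_or_iff (hasFalse_sigma k) fun _ => .refl _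
    · exact dne_sigma_or_iff (hasFalse_delta k) fun _ => reduces_delta_sigma
    · exact dne_sigma_or_iff (hasTrue_pi k).neg reduces_neg_pi_sigma
    -- The formula is replaced by its `Π_k` partner, whose negation is a `Σ_k` dual.
    · exact dne_sigma_or_iff (hasTrue_delta k).neg fun h =>
        reduces_delta_pi.neg.trans (reduces_neg_pi_sigma h)
    · exact dne_sigma_or_iff (hasFalse_sigma k).neg.neg fun h => (reduces_dn_of_dne h).1
    · exact dne_sigma_or_iff (hasFalse_delta k).neg.neg fun h =>
        reduces_delta_sigma.dn.trans (reduces_dn_of_dne h).1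
  · have h₁ : EquivHA (DNE ((SigmaC k).or (PiC k))) (DNE ((SigmaC k).or (SigmaC k).neg)) :=
      dne_or_congr
        (fun h => ⟨.refl _, (StablePred.of_dne_sigma ((hasFalse_pi k).dne h)).neg_sigma_pi⟩)
        (fun h => ⟨.refl _, (StablePred.of_dne_sigma ((hasTrue_sigma k).neg.dne h)).pi_neg_sigma⟩)
    have h₂ : EquivHA (DNE ((SigmaC k).or (PiC k))) (DNE ((SigmaC k).or (PiC k).dn)) :=
      dne_or_congr
        (fun h => ⟨.refl _, (reduces_dn_of_dne
          (StablePred.of_dne_sigma ((hasFalse_pi k).dne h)).dne_pi).1⟩)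
        (fun h => ⟨.refl _, (reduces_dn_of_dne
          (StablePred.of_dne_sigma ((hasFalse_pi k).neg.neg.dne h)).dne_pi).2⟩)
    have h₀ : EquivHA (LEM (SigmaC k)) (DNE ((SigmaC k).or (SigmaC k).neg)) :=
      ⟨dne_or_of_lem (.refl _) dne_neg, lem_of_dne_or_neg (.refl _)⟩
    exact pairwise_equivHA (by simpa using ⟨h₀.trans h₁.symm, h₀, h₀.trans (h₁.symm.trans h₂)⟩)
  · have h₀ : EquivHA (LEM (PiC k)) (DNE ((PiC k).neg.or (PiC k))) :=
      ⟨dne_or_of_lem (lem_neg (.refl _)) (dne_of_lem (.refl _)),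
        lem_of_dne_or_neg (dne_or_comm (.refl _))⟩
    have h₁ : EquivHA (DNE ((PiC k).neg.or (PiC k))) (DNE ((SigmaC k).dn.or (PiC k))) :=
      dne_or_congr
        (fun h => ⟨(StablePred.of_dne_pi
          ((hasTrue_pi k).neg.dne (dne_or_comm h))).neg_sigma_pi.neg, .refl _⟩)
        (fun h => ⟨(StablePred.of_dne_pi
          ((hasFalse_sigma k).neg.neg.dne (dne_or_comm h))).pi_neg_sigma.neg, .refl _⟩)
    exact pairwise_equivHA (by simpa using ⟨h₀, h₀.trans h₁⟩)
  · have h₁ : EquivHA (DNE ((PiC k).or (PiC k))) (DNE ((PiC k).or (SigmaC k).neg)) :=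
      dne_or_congr
        (fun h => ⟨.refl _, (StablePred.of_dne_pi ((hasFalse_pi k).dne h)).neg_sigma_pi⟩)
        (fun h => ⟨.refl _, (StablePred.of_dne_pi ((hasTrue_sigma k).neg.dne h)).pi_neg_sigma⟩)
    have h₂ : EquivHA (DNE ((PiC k).or (PiC k))) (DNE ((PiC k).or (PiC k).dn)) :=
      dne_or_congr
        (fun h => ⟨.refl _, (reduces_dn_of_dne ((hasFalse_pi k).dne h)).1⟩)
        (fun h => ⟨.refl _, (reduces_dn_of_dne ((hasFalse_pi k).neg.neg.dne h)).2⟩)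
    have h₀ := dmlDual_equiv (k := k)
    exact pairwise_equivHA (by simpa using ⟨h₀, h₀.trans h₁, h₀.trans h₂⟩)
  · intro C hC D hD
    have hl : EquivHA (LEM (DeltaC k)) (DNE ((DeltaC k).or C.neg)) := by
      obtain rfl | rfl | rfl | rfl | rfl := hC
      · exact lem_delta_equiv_left (hasTrue_sigma k).neg fun _ => reduces_delta_sigma.neg
      · exact lem_delta_equiv_left (hasTrue_pi k).neg fun _ => reduces_delta_pi.neg
      · exact lem_delta_equiv_left (hasTrue_delta k).neg fun _ => .refl _
      -- The `Π_k` partner is the negation of a `Σ_k` formula, so `¬Δ_k` falls into `¬¬Σ_k`.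
      · exact lem_delta_equiv_left (hasFalse_sigma k).neg.neg fun h =>
          (reduces_delta_pi.trans h.pi_neg_sigma).neg
      -- Here `¬Δ_k` falls into `Π_k` by duality, and stability identifies `Π_k` with `¬¬Π_k`.
      · exact lem_delta_equiv_left (hasFalse_pi k).neg.neg fun h =>
          (reduces_delta_sigma.neg.trans h.neg_sigma_pi).trans (reduces_dn_of_dne h.dne_pi).2
    have hr : EquivHA (LEM (DeltaC k)) (DNE (D.or (PiC k))) := by
      obtain rfl | rfl | rfl := hD
      · exact lem_delta_equiv_right (hasFalse_delta k) id lem_delta_of_dne_or_pi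
      -- The `Π_k` partner of the same formula serves as second disjunct, giving `DNE` of `¬Δ_k ∨
      -- Δ_k`.
      · exact lem_delta_equiv_right (hasTrue_delta k).neg lem_neg fun _ h =>
          lem_of_dne_or_neg (dne_or_comm ((Reduces.refl _).dne_or reduces_delta_pi h))
      · exact lem_delta_equiv_right (hasFalse_delta k).neg.neg (fun h => lem_neg (lem_neg h))
          fun hs h => lem_delta_of_dne_or_pi hs
            ((reduces_dn_of_dne hs.dne_delta).2.dne_or (.refl _) h)
    exact pairwise_equivHA (by simpa using ⟨hl, hr⟩)
  · have h₁ : EquivHA (DNE ((DeltaC k).or (DeltaC k))) (DNE ((DeltaC k).or (DeltaC k).dn)) :=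
      dne_or_congr
        (fun h => ⟨.refl _, (reduces_dn_of_dne ((hasFalse_delta k).dne h)).1⟩)
        (fun h => ⟨.refl _, (reduces_dn_of_dne ((hasFalse_delta k).neg.neg.dne h)).2⟩)
    have h₂ : EquivHA (DNE ((DeltaC k).or (DeltaC k))) (DML (DeltaC k).neg ∪ DNE (SigmaPredC k)) := by
      refine ⟨derives_union_iff.2 ⟨dml_of_dne_or (.refl _),
        reduces_sigmaPred_delta.dne ((hasFalse_delta k).dne (.refl _))⟩, ?_⟩
      obtain ⟨h, h'⟩ := derives_union_iff.1 (Derives.refl (DML (DeltaC k).neg ∪ DNE (SigmaPredC k)))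
      exact dne_or_of_dml h (derives_dne_sigmaPred_iff.1 h').dne_delta
    exact pairwise_equivHA (by simpa using ⟨h₁, h₂⟩)
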